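/- Tensor products of C*-algebras are maximal C*-tensor products, and infinite tensor products of matrix algebras are C*-algebraic inductive limits of the finite ones. A state of a unital C*-algebra is a unital positive linear functional. For a unit vector $\varphi\in\mathbb C^N\otimes\mathbb C^N$ let $s_\varphi(M)=\langle\varphi|M|\varphi\rangle$ on $\mathbb M_N\otimes\mathbb M_N$, and let $s_0(M)=\langle 0|M|0\rangle$ on $\mathbb M_N$. Given unital C*-algebras $\mathcal A,\mathcal B$ and a state $s$ on $\mathcal A\otimes\mathcal B$ (the catalyst), *-automorphisms $\alpha$ of $\mathcal A\otimes\mathbb M_N$ and $\beta$ of $\mathcal B\otimes\mathbb M_N$ exactly embezzle $\varphi$ if, up to the order of the tensor factors, $$(s\otimes s_0\otimes s_0)\big((\alpha\otimes\beta)(X)\big)=(s\otimes s_\varphi)(X)\qquad\text{for all }X\in\mathcal A\otimes\mathcal B\otimes\mathbb M_N\otimes\mathbb M_N .$$ For $n\ge 1$ let $\mathbf Q_n$ be the set of vectors $q\in\mathbb R^{2^n}$ with $q_i>0$, $q_i^2\in\mathbb Q$ and $\sum_i q_i^2=1$, and put $\varphi_q=\sum_i q_i|ii\rangle\in\mathbb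 C^{2^n}\otimes\mathbb C^{2^n}$. Let $$\mathcal M=\bigotimes_{n\ge 1}\ \bigotimes_{q\in\mathbf Q_n}\ \bigotimes_{i\in\mathbb Z}\mathbb M_{2^n}.$$ **Theorem.** 1. Each $\mathbf Q_n$ is countable and dense in the set of all vectors $q\in\mathbb R^{2^n}$ with $q_i\ge 0$ and $\sum_i q_i^2=1$. The set $D_n$ of all vectors $(U\otimes V)\varphi_q$, with $q\in\mathbf Q_n$ and $U,V$ unitary $2^n\times 2^n$ matrices, consists of unit vectors and is dense in the unit sphere of $\mathbb C^{2^n}\otimes\mathbb C^{2^n}$. 2. The C*-algebra $\mathcal M$ is separable, and both $\mathcal M$ and $\mathcal M\otimes\mathcal M$ are *-isomorphic to the CAR algebra $\bigotimes_{\mathbb N}\mathbb M_2$. 3. There is a unique state $s$ on $\mathcal M\otimes\mathcal M$ that is the infinite tensor product of the following vector states: on the pair of factors $\mathbb M_{2^n}\otimes\mathbb M_{2^n}$ with index $(n,q,i)$, one in each copy of $\mathcal M$, the state $s_{\varphi_q}$ if $i\ge 1$ and the state $s_{|00\rangle}$ if $i\le 0$. 4. With $\mathcal A=\mathcal B=\mathcal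 M$, the single catalyst $s$ allows the exact embezzlement of every $\varphi\in D_n$, simultaneously for all $n\ge1$. Explicitly, for all $n\ge 1$ and $q\in\mathbf Q_n$ there is a *-automorphism $\alpha_q$ of $\mathcal M\otimes\mathbb M_{2^n}$ that fixes all factors of $\mathcal M$ with an index $(n',q',i)$, $(n',q')\ne(n,q)$, maps the factor $(n,q,i)$ identically onto the factor $(n,q,i+1)$ for $i\ne 0$, maps the factor $(n,q,0)$ identically onto the external factor $\mathbb M_{2^n}$, and maps the external factor identically onto the factor $(n,q,1)$. For all unitary $U,V$, the *-automorphisms $x\mapsto\alpha_q\big((1\otimes U)^*x(1\otimes U)\big)$ for Alice and $x\mapsto\alpha_q\big((1\otimes V)^*x(1\otimes V)\big)$ for Bob exactly embezzle $(U\otimes V)\varphi_q$ with the catalyst $s$. -/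

import Mathlib

open scoped TensorProduct ComplexOrder Matrix.Norms.L2Operator Kronecker

noncomputable section

/-! ### Completion of a complex *-algebra in a C*-seminorm -/

/-- A C*-seminorm on a unital complex *-algebra. -/
structure CStarSeminorm (E : Type*) [Ring E] [StarRing E] [Algebra ℂ E] extends
    Seminorm ℂ E where
  mul_le' : ∀ x y, toFun (x * y) ≤ toFun x * toFun y
  star_mul_self' : ∀ x, toFun (star x * x) = toFun x * toFun x

namespace CStarSeminorm

variable {E : Type*} [Ring E] [StarRing E] [Algebra ℂ E]

instance : CoeFun (CStarSeminorm E) fun _ => E → ℝ := ⟨fun p => p.toFun⟩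

theorem le_star (p : CStarSeminorm E) (x : E) : p x ≤ p (star x) := by
  have h1 := p.star_mul_self' x
  have h2 := p.mul_le' (star x) x
  have h3 : 0 ≤ p x := apply_nonneg p.toSeminorm x
  have h4 : 0 ≤ p (star x) := apply_nonneg p.toSeminorm (star x)
  rcases h3.eq_or_lt with h | h
  · exact h ▸ h4
  · exact le_of_mul_le_mul_right (h1 ▸ h2) h

theorem star_eq (p : CStarSeminorm E) (x : E) : p (star x) = p x :=
  le_antisymm (by simpa using p.le_star (star x)) (p.le_star x)

/-- The *-algebra `E`, equipped with the topology of the seminorm `p`. -/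
@[nolint unusedArguments]
def Carrier (_ : CStarSeminorm E) : Type _ := E

variable (p : CStarSeminorm E)

instance : Ring p.Carrier := inferInstanceAs (Ring E)
instance : StarRing p.Carrier := inferInstanceAs (StarRing E)
instance : Algebra ℂ p.Carrier := inferInstanceAs (Algebra ℂ E)

instance : SeminormedRing p.Carrier where
  __ : Ring p.Carrier := inferInstance
  __ : SeminormedAddCommGroup p.Carrier :=
    AddGroupSeminorm.toSeminormedAddCommGroup (E := p.Carrier) p.toSeminorm.toAddGroupSeminorm
  norm_mul_le := p.mul_le'

theorem norm_def (x : p.Carrier) : ‖x‖ = p x := rfl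

instance : NormedAlgebra ℂ p.Carrier where
  norm_smul_le c x := (p.smul' c x).le

instance : NormedStarGroup p.Carrier where
  norm_star_le x := (p.star_eq x).le

/-- The Hausdorff completion of `E` in the seminorm `p`. -/
def Completion : Type _ := UniformSpace.Completion p.Carrier

namespace Completion

open UniformSpace.Completion

instance : NormedRing p.Completion :=
  inferInstanceAs (NormedRing (UniformSpace.Completion p.Carrier))

instance : CompleteSpace p.Completion :=
  inferInstanceAs (CompleteSpace (UniformSpace.Completion p.Carrier))

instance : Algebra ℂ p.Completion :=
  inferInstanceAs (Algebra ℂ (UniformSpace.Completion p.Carrier))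

instance : NormedAlgebra ℂ p.Completion where
  norm_smul_le c x := norm_smul_le (β := UniformSpace.Completion p.Carrier) c x

instance : Star p.Completion where
  star := UniformSpace.Completion.map (star : p.Carrier → p.Carrier)

/-- The canonical map of `E` to its completion. -/
def of (x : E) : p.Completion := UniformSpace.Completion.coe' (α := p.Carrier) x

theorem of_star (x : E) : star (of p x) = of p (star x) :=
  map_coe (star_isometry (E := p.Carrier)).uniformContinuous x

theorem continuous_star' : Continuous (star : p.Completion → p.Completion) :=
  UniformSpace.Completion.continuous_map

theorem of_mul (x y : E) : of p (x * y) = of p x * of p y :=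
  UniformSpace.Completion.coe_mul (α := p.Carrier) x y

theorem of_add (x y : E) : of p (x + y) = of p x + of p y :=
  UniformSpace.Completion.coe_add (α := p.Carrier) x y

theorem of_smul (c : ℂ) (x : E) : of p (c • x) = c • of p x :=
  UniformSpace.Completion.coe_smul (X := p.Carrier) c x

theorem norm_of (x : E) : ‖of p x‖ = p x :=
  UniformSpace.Completion.norm_coe (E := p.Carrier) x

theorem denseRange_of : DenseRange (of p) :=
  UniformSpace.Completion.denseRange_coe (α := p.Carrier)

theorem ind {P : p.Completion → Prop} (x : p.Completion) (hc : IsClosed {x | P x})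
    (h : ∀ a, P (of p a)) : P x :=
  UniformSpace.Completion.induction_on (α := p.Carrier) x hc h

theorem ind₂ {P : p.Completion → p.Completion → Prop} (x y : p.Completion)
    (hc : IsClosed {z : p.Completion × p.Completion | P z.1 z.2})
    (h : ∀ a b, P (of p a) (of p b)) : P x y :=
  UniformSpace.Completion.induction_on₂ (α := p.Carrier) (β := p.Carrier) x y hc h

instance : StarRing p.Completion where
  star_involutive x := by
    refine ind p (P := fun x => star (star x) = x) x (isClosed_eq ?_ continuous_id) fun a => ?_
    · exact (continuous_star' p).comp (continuous_star' p)
    · rw [of_star, of_star, star_star]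
  star_mul x y := by
    have hs := continuous_star' p
    refine ind₂ p (P := fun x y => star (x * y) = star y * star x) x y
      (isClosed_eq ?_ ?_) fun a b => ?_
    · exact hs.comp (continuous_fst.mul continuous_snd)
    · exact (hs.comp continuous_snd).mul (hs.comp continuous_fst)
    · rw [← of_mul, of_star, of_star, of_star, star_mul, of_mul]
  star_add x y := by
    have hs := continuous_star' p
    refine ind₂ p (P := fun x y => star (x + y) = star x + star y) x y
      (isClosed_eq ?_ ?_) fun a b => ?_
    · exact hs.comp (continuous_fst.add continuous_snd)
    · exact (hs.comp continuous_fst).add (hs.comp continuous_snd)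
    · rw [← of_add, of_star, of_star, of_star, star_add, of_add]

instance [StarModule ℂ E] : StarModule ℂ p.Completion where
  star_smul c x := by
    have hs := continuous_star' p
    refine ind p (P := fun x => star (c • x) = star c • star x) x
      (isClosed_eq (hs.comp (continuous_const_smul c)) ((continuous_const_smul (star c)).comp hs)) fun a => ?_
    rw [← of_smul, of_star, of_star, star_smul, of_smul]

instance : CStarRing p.Completion where
  norm_mul_self_le x := by
    have hs := continuous_star' p
    refine ind p (P := fun x => ‖x‖ * ‖x‖ ≤ ‖star x * x‖) x (isClosed_le (by fun_prop) ?_) fun a => ?_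
    · exact (hs.mul continuous_id).norm
    · rw [of_star, ← of_mul, norm_of, norm_of]
      exact (p.star_mul_self' a).ge

instance [StarModule ℂ E] : CStarAlgebra p.Completion where

/-- The canonical *-homomorphism of `E` to its completion. -/
def ofHom : E →⋆ₐ[ℂ] p.Completion where
  toFun := of p
  map_one' := UniformSpace.Completion.coe_one p.Carrier
  map_mul' := of_mul p
  map_zero' := UniformSpace.Completion.coe_zero (α := p.Carrier)
  map_add' := of_add p
  commutes' _ := rfl
  map_star' x := (of_star p x).symm

/-- A *-homomorphism out of `E`, seen as a ring homomorphism out of the seminormed ring. -/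
def carrierHom {C : Type*} [CStarAlgebra C] (f : E →⋆ₐ[ℂ] C) : p.Carrier →+* C :=
  f.toAlgHom.toRingHom

theorem continuous_carrierHom {C : Type*} [CStarAlgebra C] (f : E →⋆ₐ[ℂ] C)
    (hf : ∀ x, ‖f x‖ ≤ p x) : Continuous (carrierHom p f) :=
  AddMonoidHomClass.continuous_of_bound (carrierHom p f) 1 fun x =>
    (hf x).trans (one_mul (p x)).ge

theorem extensionHom_of {C : Type*} [CStarAlgebra C] (f : E →⋆ₐ[ℂ] C)
    (hf : ∀ x, ‖f x‖ ≤ p x) (x : E) :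
    UniformSpace.Completion.extensionHom (carrierHom p f) (continuous_carrierHom p f hf)
      (of p x) = f x :=
  UniformSpace.Completion.extensionHom_coe (carrierHom p f) (continuous_carrierHom p f hf) x

/-- A *-homomorphism of `E` to a C*-algebra that is dominated by `p` extends to the completion. -/
def extend {C : Type*} [CStarAlgebra C] (f : E →⋆ₐ[ℂ] C) (hf : ∀ x, ‖f x‖ ≤ p x) :
    p.Completion →⋆ₐ[ℂ] C where
  toFun := UniformSpace.Completion.extensionHom (carrierHom p f) (continuous_carrierHom p f hf)
  map_one' := map_one (UniformSpace.Completion.extensionHom _ (continuous_carrierHom p f hf))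
  map_mul' := map_mul (UniformSpace.Completion.extensionHom _ (continuous_carrierHom p f hf))
  map_zero' := map_zero (UniformSpace.Completion.extensionHom _ (continuous_carrierHom p f hf))
  map_add' := map_add (UniformSpace.Completion.extensionHom _ (continuous_carrierHom p f hf))
  commutes' c := (extensionHom_of p f hf (algebraMap ℂ E c)).trans (AlgHomClass.commutes f c)
  map_star' x := by
    have hs := continuous_star' p
    have he : Continuous (UniformSpace.Completion.extensionHom (carrierHom p f)
      (continuous_carrierHom p f hf)) := UniformSpace.Completion.continuous_extension
    refine ind p (P := fun x => UniformSpace.Completion.extensionHom (carrierHom p f)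
      (continuous_carrierHom p f hf) (show p.Completion from star x) = star (UniformSpace.Completion.extensionHom
        (carrierHom p f) (continuous_carrierHom p f hf) x)) x
      (isClosed_eq (he.comp hs) he.star) fun a => ?_
    rw [of_star]
    exact (extensionHom_of p f hf _).trans
      ((map_star f a).trans (congrArg star (extensionHom_of p f hf a).symm))

theorem extend_of {C : Type*} [CStarAlgebra C] (f : E →⋆ₐ[ℂ] C) (hf : ∀ x, ‖f x‖ ≤ p x) (x : E) :
    extend p f hf (ofHom p x) = f x :=
  extensionHom_of p f hf x

end Completion

end CStarSeminorm

/-! ### The maximal tensor product of unital C*-algebras -/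

namespace MaxTensor

variable {A B : Type*} [CStarAlgebra A] [CStarAlgebra B]

/-- `A → A ⊗ B`, `a ↦ a ⊗ 1`, on the algebraic tensor product. -/
def algInl : A →⋆ₐ[ℂ] A ⊗[ℂ] B :=
  { (Algebra.TensorProduct.includeLeft : A →ₐ[ℂ] A ⊗[ℂ] B) with
    map_star' := fun a => by simp }

/-- `B → A ⊗ B`, `b ↦ 1 ⊗ b`, on the algebraic tensor product. -/
def algInr : B →⋆ₐ[ℂ] A ⊗[ℂ] B :=
  { (Algebra.TensorProduct.includeRight : B →ₐ[ℂ] A ⊗[ℂ] B) with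
    map_star' := fun b => by simp }

theorem seminorm_tmul_le (p : CStarSeminorm (A ⊗[ℂ] B)) (a : A) (b : B) :
    p (a ⊗ₜ b) ≤ ‖a‖ * ‖b‖ := by
  have ha : p (a ⊗ₜ 1) ≤ ‖a‖ := by
    rw [← CStarSeminorm.Completion.norm_of]
    exact NonUnitalStarAlgHom.norm_apply_le
      ((CStarSeminorm.Completion.ofHom p).comp (algInl (A := A) (B := B))) a
  have hb : p (1 ⊗ₜ b) ≤ ‖b‖ := by
    rw [← CStarSeminorm.Completion.norm_of]
    exact NonUnitalStarAlgHom.norm_apply_le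
      ((CStarSeminorm.Completion.ofHom p).comp (algInr (A := A) (B := B))) b
  have h : a ⊗ₜ[ℂ] b = (a ⊗ₜ 1) * (1 ⊗ₜ b) := by simp
  rw [h]
  exact (p.mul_le' _ _).trans
    (mul_le_mul ha hb (apply_nonneg p.toSeminorm _) (norm_nonneg a))

theorem bddAbove_seminorm (x : A ⊗[ℂ] B) :
    BddAbove (Set.range fun p : CStarSeminorm (A ⊗[ℂ] B) => p x) := by
  induction x with
  | zero => exact ⟨0, by rintro _ ⟨p, rfl⟩; exact (map_zero p.toSeminorm).le⟩
  | tmul a b => exact ⟨‖a‖ * ‖b‖, by rintro _ ⟨p, rfl⟩; exact seminorm_tmul_le p a b⟩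
  | add x y hx hy =>
    obtain ⟨c, hc⟩ := hx
    obtain ⟨d, hd⟩ := hy
    refine ⟨c + d, ?_⟩
    rintro _ ⟨p, rfl⟩
    exact (map_add_le_add p.toSeminorm x y).trans (add_le_add (hc ⟨p, rfl⟩) (hd ⟨p, rfl⟩))

theorem le_ciSup_seminorm (p : CStarSeminorm (A ⊗[ℂ] B)) (x : A ⊗[ℂ] B) :
    p x ≤ ⨆ q : CStarSeminorm (A ⊗[ℂ] B), q x :=
  le_ciSup (bddAbove_seminorm x) p

instance : Nonempty (CStarSeminorm (A ⊗[ℂ] B)) :=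
  ⟨{ (0 : Seminorm ℂ (A ⊗[ℂ] B)) with
      mul_le' := fun _ _ => (mul_zero (0 : ℝ)).ge
      star_mul_self' := fun _ => (mul_zero (0 : ℝ)).symm }⟩

theorem ciSup_seminorm_nonneg (x : A ⊗[ℂ] B) : 0 ≤ ⨆ q : CStarSeminorm (A ⊗[ℂ] B), q x :=
  Real.iSup_nonneg fun p => apply_nonneg p.toSeminorm x

variable (A B) in
/-- The maximal C*-seminorm of the algebraic tensor product: the supremum of all its
C*-seminorms. -/
def maxSeminorm : CStarSeminorm (A ⊗[ℂ] B) where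
  toFun x := ⨆ p : CStarSeminorm (A ⊗[ℂ] B), p x
  map_zero' := by
    refine le_antisymm (ciSup_le fun p => (map_zero p.toSeminorm).le) (ciSup_seminorm_nonneg 0)
  add_le' x y := ciSup_le fun p => (map_add_le_add p.toSeminorm x y).trans
    (add_le_add (le_ciSup_seminorm p x) (le_ciSup_seminorm p y))
  neg' x := iSup_congr fun p => map_neg_eq_map p.toSeminorm x
  smul' c x := by
    rw [Real.mul_iSup_of_nonneg (norm_nonneg c)]
    exact iSup_congr fun p => map_smul_eq_mul p.toSeminorm c x
  mul_le' x y := ciSup_le fun p => (p.mul_le' x y).trans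
    (mul_le_mul (le_ciSup_seminorm p x) (le_ciSup_seminorm p y)
      (apply_nonneg p.toSeminorm y) (ciSup_seminorm_nonneg x))
  star_mul_self' x := by
    refine le_antisymm (ciSup_le fun p => ?_) ?_
    · refine (p.star_mul_self' x).le.trans ?_
      exact mul_self_le_mul_self (apply_nonneg p.toSeminorm x) (le_ciSup_seminorm p x)
    · have h : ⨆ p : CStarSeminorm (A ⊗[ℂ] B), p x ≤
          √(⨆ p : CStarSeminorm (A ⊗[ℂ] B), p (star x * x)) :=
        ciSup_le fun p => Real.le_sqrt_of_sq_le <| by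
          rw [sq, ← p.star_mul_self' x]
          exact le_ciSup_seminorm p (star x * x)
      refine (mul_self_le_mul_self (ciSup_seminorm_nonneg x) h).trans ?_
      rw [Real.mul_self_sqrt (ciSup_seminorm_nonneg _)]

end MaxTensor

/-- The maximal C*-tensor product `A ⊗ B`. -/
def MaxTensor (A B : Type*) [CStarAlgebra A] [CStarAlgebra B] : Type _ :=
  (MaxTensor.maxSeminorm A B).Completion

namespace MaxTensor

variable {A B C : Type*} [CStarAlgebra A] [CStarAlgebra B] [CStarAlgebra C]

instance : CStarAlgebra (MaxTensor A B) :=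
  inferInstanceAs (CStarAlgebra (MaxTensor.maxSeminorm A B).Completion)

/-- The canonical *-homomorphism of the algebraic into the maximal tensor product. -/
def ofAlg : A ⊗[ℂ] B →⋆ₐ[ℂ] MaxTensor A B :=
  CStarSeminorm.Completion.ofHom (maxSeminorm A B)

/-- The elementary tensor `a ⊗ b`. -/
def tmul (a : A) (b : B) : MaxTensor A B := ofAlg (a ⊗ₜ b)

/-- `A → A ⊗ B`, `a ↦ a ⊗ 1`. -/
def inl : A →⋆ₐ[ℂ] MaxTensor A B := ofAlg.comp algInl

/-- `B → A ⊗ B`, `b ↦ 1 ⊗ b`. -/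
def inr : B →⋆ₐ[ℂ] MaxTensor A B := ofAlg.comp algInr

/-- The *-homomorphism `a ⊗ b ↦ f a * g b` on the algebraic tensor product. -/
def algLift (f : A →⋆ₐ[ℂ] C) (g : B →⋆ₐ[ℂ] C) (h : ∀ a b, Commute (f a) (g b)) :
    A ⊗[ℂ] B →⋆ₐ[ℂ] C :=
  { Algebra.TensorProduct.lift f.toAlgHom g.toAlgHom h with
    map_star' := fun x => by
      change Algebra.TensorProduct.lift f.toAlgHom g.toAlgHom h (star x) =
        star (Algebra.TensorProduct.lift f.toAlgHom g.toAlgHom h x)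
      induction x with
      | zero => simp
      | tmul a b =>
        simp only [TensorProduct.star_tmul, Algebra.TensorProduct.lift_tmul]
        change f (star a) * g (star b) = star (f a * g b)
        rw [map_star, map_star, ← star_mul, (h a b).eq]
      | add x y hx hy => rw [star_add, map_add, map_add, hx, hy, star_add] }

/-- The C*-seminorm `x ↦ ‖f x‖` of a *-homomorphism `f` to a C*-algebra. -/
def homSeminorm (f : A ⊗[ℂ] B →⋆ₐ[ℂ] C) : CStarSeminorm (A ⊗[ℂ] B) where
  toFun x := ‖f x‖
  map_zero' := by simp
  add_le' x y := by simpa using norm_add_le (f x) (f y)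
  neg' x := by simp
  smul' c x := by simp [norm_smul]
  mul_le' x y := by simpa using norm_mul_le (f x) (f y)
  star_mul_self' x := by
    rw [map_mul, map_star, CStarRing.norm_star_mul_self]

/-- Universal property: *-homomorphisms of `A` and `B` with commuting ranges define a
*-homomorphism of `A ⊗ B`. -/
def lift (f : A →⋆ₐ[ℂ] C) (g : B →⋆ₐ[ℂ] C) (h : ∀ a b, Commute (f a) (g b)) :
    MaxTensor A B →⋆ₐ[ℂ] C :=
  CStarSeminorm.Completion.extend (maxSeminorm A B) (algLift f g h)
    (le_ciSup_seminorm (homSeminorm (algLift f g h)))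

theorem lift_tmul (f : A →⋆ₐ[ℂ] C) (g : B →⋆ₐ[ℂ] C) (h : ∀ a b, Commute (f a) (g b))
    (a : A) (b : B) : lift f g h (tmul a b) = f a * g b :=
  CStarSeminorm.Completion.extend_of (maxSeminorm A B) _ _ (a ⊗ₜ b)

theorem commute_inl_inr (a : A) (b : B) : Commute (inl a : MaxTensor A B) (inr b) := by
  have h : Commute (a ⊗ₜ[ℂ] (1 : B)) ((1 : A) ⊗ₜ[ℂ] b) := by simp [Commute, SemiconjBy]
  exact h.map (ofAlg (A := A) (B := B))

/-- The tensor product `f ⊗ g` of two *-homomorphisms. -/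
def map {A' B' : Type*} [CStarAlgebra A'] [CStarAlgebra B'] (f : A →⋆ₐ[ℂ] A')
    (g : B →⋆ₐ[ℂ] B') : MaxTensor A B →⋆ₐ[ℂ] MaxTensor A' B' :=
  lift (inl.comp f) (inr.comp g) fun a b => commute_inl_inr (f a) (g b)

end MaxTensor
/-! ### Infinite tensor products of matrix algebras -/

namespace InfTensor

variable {ι : Type*} (d : ι → ℕ)

/-- Configurations: a basis label at every site. -/
abbrev Config : Type _ := ∀ i, Fin (d i)

/-- The Hilbert space with an orthonormal basis labelled by the configurations. -/
abbrev Hilb : Type _ := lp (fun _ : Config d => ℂ) 2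

variable {d}

open scoped Classical in
/-- Exchange of the labels `k` and `l` at the site `i`. -/
def flip (i : ι) (k l : Fin (d i)) : Equiv.Perm (Config d) where
  toFun x := Function.update x i (Equiv.swap k l (x i))
  invFun x := Function.update x i (Equiv.swap k l (x i))
  left_inv x := by simp
  right_inv x := by simp

theorem flip_apply_self (i : ι) (k l : Fin (d i)) (x : Config d) :
    flip i k l x i = Equiv.swap k l (x i) := by
  simp [flip]

theorem summable_sq (f : Hilb d) : Summable fun x => ‖f x‖ ^ 2 := by
  simpa using (lp.memℓp f).summable (by norm_num)

theorem memℓp_of_le {g : Config d → ℂ} (f : Hilb d) (σ : Equiv.Perm (Config d))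
    (h : ∀ x, ‖g x‖ ≤ ‖f (σ x)‖) : Memℓp g 2 := by
  refine memℓp_gen ?_
  have := (summable_sq f).comp_injective σ.injective
  refine Summable.of_nonneg_of_le (fun x => by positivity) (fun x => ?_) this
  simpa using pow_le_pow_left₀ (norm_nonneg _) (h x) 2

theorem norm_unit_le (i : ι) (k l : Fin (d i)) (f : Hilb d) (x : Config d) :
    ‖if x i = k then f (flip i k l x) else 0‖ ≤ ‖f (flip i k l x)‖ := by
  split_ifs
  · exact le_rfl
  · rw [norm_zero]; exact norm_nonneg _

/-- The matrix unit `|k⟩⟨l|` at the site `i`, acting on the configuration space: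
the basis vector of a configuration with label `l` at `i` is mapped to that of the same
configuration with label `k` at `i`, and the other basis vectors are mapped to zero. -/
def matrixUnit (i : ι) (k l : Fin (d i)) : Hilb d →L[ℂ] Hilb d :=
  LinearMap.mkContinuous
    { toFun := fun f => ⟨fun x => if x i = k then f (flip i k l x) else 0,
        memℓp_of_le f (flip i k l) (norm_unit_le i k l f)⟩
      map_add' := fun f g => lp.ext <| funext fun x => by
        change (if x i = k then f (flip i k l x) + g (flip i k l x) else 0) =
          (if x i = k then f (flip i k l x) else 0) + (if x i = k then g (flip i k l x) else 0)
        split_ifs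
        · rfl
        · exact (add_zero 0).symm
      map_smul' := fun c f => lp.ext <| funext fun x => by
        change (if x i = k then c * f (flip i k l x) else 0) =
          c * (if x i = k then f (flip i k l x) else 0)
        split_ifs
        · rfl
        · exact (mul_zero c).symm }
    1 fun f => by
      have h2 : (0 : ℝ) < (2 : ENNReal).toReal := by norm_num
      have hf := ((lp.memℓp f).summable h2).comp_injective (flip i k l).injective
      have hle : ∀ x, ‖if x i = k then f (flip i k l x) else 0‖ ^ (2 : ENNReal).toReal ≤
          ‖f (flip i k l x)‖ ^ (2 : ENNReal).toReal := fun x =>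
        Real.rpow_le_rpow (norm_nonneg _) (norm_unit_le i k l f x) h2.le
      rw [one_mul]
      refine lp.norm_le_of_tsum_le h2 (norm_nonneg f) ?_
      rw [lp.norm_rpow_eq_tsum h2 f,
        ← (flip i k l).tsum_eq fun x => ‖f x‖ ^ (2 : ENNReal).toReal]
      exact Summable.tsum_le_tsum hle
        (Summable.of_nonneg_of_le (fun x => Real.rpow_nonneg (norm_nonneg _) _) hle hf) hf

theorem matrixUnit_apply (i : ι) (k l : Fin (d i)) (f : Hilb d) (x : Config d) :
    matrixUnit i k l f x = if x i = k then f (flip i k l x) else 0 := rfl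

theorem matrixUnit_mul (i : ι) (k l k' l' : Fin (d i)) :
    matrixUnit i k l * matrixUnit i k' l' = if l = k' then matrixUnit i k l' else 0 := by
  ext f x
  change matrixUnit i k l (matrixUnit i k' l' f) x = _
  rw [matrixUnit_apply, matrixUnit_apply, flip_apply_self]
  by_cases hx : x i = k
  · by_cases h : l = k'
    · subst h
      simp only [hx, if_true, Equiv.swap_apply_left, matrixUnit_apply]
      simp [flip, hx]
    · simp [hx, h]
  · by_cases h : l = k'
    · simp [h, hx, matrixUnit_apply]
    · simp [h, hx]

theorem sum_matrixUnit (i : ι) : ∑ k, matrixUnit (d := d) i k k = 1 := by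
  ext f x
  have h : ∀ k, matrixUnit (d := d) i k k f x = if x i = k then f x else 0 := fun k => by
    rw [matrixUnit_apply]
    simp [flip]
  rw [sum_apply, lp.coeFn_sum, Finset.sum_apply, Finset.sum_congr rfl fun k _ => h k]
  simp

theorem star_matrixUnit (i : ι) (k l : Fin (d i)) :
    star (matrixUnit i k l) = matrixUnit i l k := by
  rw [ContinuousLinearMap.star_eq_adjoint]
  symm
  rw [ContinuousLinearMap.eq_adjoint_iff]
  intro f g
  rw [lp.inner_eq_tsum, lp.inner_eq_tsum, ← (flip i k l).tsum_eq]
  refine tsum_congr fun x => ?_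
  rw [matrixUnit_apply, matrixUnit_apply, flip_apply_self]
  have h : flip i l k (flip i k l x) = x := by
    have : flip i l k = flip i k l := by ext; simp [flip, Equiv.swap_comm]
    rw [this]; exact (flip i k l).left_inv x
  rw [h]
  by_cases hx : x i = k
  · simp [hx]
  · have : Equiv.swap k l (x i) ≠ l := fun h' => hx (by
      simpa using congrArg (Equiv.swap k l) h')
    simp [hx, this]

/-- The matrix algebra of the site `i`, acting on the configuration space. -/
def siteRep (i : ι) : Matrix (Fin (d i)) (Fin (d i)) ℂ →⋆ₐ[ℂ] (Hilb d →L[ℂ] Hilb d) where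
  toFun m := ∑ k, ∑ l, m k l • matrixUnit i k l
  map_one' := by
    simp [Matrix.one_apply, ite_smul, sum_matrixUnit]
  map_mul' m m' := by
    simp only [Finset.sum_mul, Finset.mul_sum, smul_mul_smul_comm, matrixUnit_mul,
      Matrix.mul_apply, Finset.sum_smul]
    simp
    rw [Finset.sum_comm, Finset.sum_congr rfl fun l _ => Finset.sum_comm]
    exact Finset.sum_comm
  map_zero' := by simp
  map_add' m m' := by simp [add_smul, Finset.sum_add_distrib]
  commutes' c := by
    simp [Matrix.algebraMap_matrix_apply, ite_smul, ← Finset.smul_sum, sum_matrixUnit,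
      Algebra.algebraMap_eq_smul_one]
  map_star' m := by
    simp only [star_sum, star_smul, star_matrixUnit, Matrix.star_apply]
    exact Finset.sum_comm

end InfTensor

open InfTensor in
/-- The norm closure of the *-algebra generated by the matrix algebras of all the sites, that is,
of the increasing union, over the finite sets `F` of sites, of the algebras `⨂_{i ∈ F} M_{d i}`,
each included in the next by `a ↦ a ⊗ 1`. These algebras act faithfully on the configuration
space, so that the operator norm restricts to their C*-norm. -/
def InfTensor.subalgebra {ι : Type*} (d : ι → ℕ) : StarSubalgebra ℂ (Hilb d →L[ℂ] Hilb d) :=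
  (StarAlgebra.adjoin ℂ (⋃ i, Set.range (siteRep (d := d) i))).topologicalClosure

/-- The infinite C*-tensor product `⨂ᵢ M_{d i}`: the C*-algebraic inductive limit of the matrix
algebras `⨂_{i ∈ F} M_{d i}` over the finite sets `F` of sites. -/
def InfTensor {ι : Type*} (d : ι → ℕ) : Type _ := InfTensor.subalgebra d

namespace InfTensor

variable {ι : Type*} (d : ι → ℕ)

instance : CStarAlgebra (InfTensor d) :=
  StarSubalgebra.cstarAlgebra (InfTensor.subalgebra d)
    (h_closed := StarSubalgebra.isClosed_topologicalClosure _)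

variable {d}

/-- The embedding of the `i`-th matrix algebra. -/
def site (i : ι) : Matrix (Fin (d i)) (Fin (d i)) ℂ →⋆ₐ[ℂ] InfTensor d :=
  (siteRep i).codRestrict (InfTensor.subalgebra d) fun m =>
    StarSubalgebra.le_topologicalClosure _
      (StarAlgebra.subset_adjoin ℂ _ (Set.mem_iUnion.2 ⟨i, m, rfl⟩))

end InfTensor

/-- The CAR algebra `⨂_{ℕ} M₂`. -/
abbrev CARAlgebra : Type := InfTensor fun _ : ℕ => 2

/-! ### States and embezzlement in the C*-model -/

/-- A state of a unital C*-algebra: a unital positive linear functional. -/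
structure IsState {A : Type*} [CStarAlgebra A] (s : A →ₗ[ℂ] ℂ) : Prop where
  nonneg : ∀ a, 0 ≤ s (star a * a)
  map_one : s 1 = 1

/-- The matrix algebra `M_N`. -/
abbrev Mat (N : ℕ) : Type := Matrix (Fin N) (Fin N) ℂ

/-- Vectors of the bipartite space `ℂ^N ⊗ ℂ^N`, in the basis `|k⟩ ⊗ |l⟩`. -/
abbrev BiVec (N : ℕ) : Type := EuclideanSpace ℂ (Fin N × Fin N)

/-- The expectation value `⟨φ| m ⊗ m' |φ⟩`. -/
def expect {N : ℕ} (φ : BiVec N) (m m' : Mat N) : ℂ :=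
  inner ℂ φ (WithLp.toLp 2 ((m ⊗ₖ m').mulVec φ.ofLp))

/-- The product vector `|0⟩ ⊗ |0⟩`. -/
def ket00 (N : ℕ) [NeZero N] : BiVec N := EuclideanSpace.single (0, 0) 1

section Embezzlement

variable {A B : Type*} [CStarAlgebra A] [CStarAlgebra B] {N : ℕ}

/-- `σ` is the state `s ⊗ s_φ`, with the tensor factors in the order `(A ⊗ M_N) ⊗ (B ⊗ M_N)`. It is
determined by its values on the elementary tensors. -/
structure IsTensorVectorState (s : MaxTensor A B →ₗ[ℂ] ℂ) (φ : BiVec N)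
    (σ : MaxTensor (MaxTensor A (Mat N)) (MaxTensor B (Mat N)) →ₗ[ℂ] ℂ) : Prop where
  isState : IsState σ
  apply_tmul : ∀ a m b m', σ (.tmul (.tmul a m) (.tmul b m')) = s (.tmul a b) * expect φ m m'

/-- With the catalyst `s`, the local *-automorphisms `α` and `β` embezzle the target `φ` exactly:
`(s ⊗ s_0 ⊗ s_0) ((α ⊗ β) X) = (s ⊗ s_φ) X` for all `X`. -/
def Embezzles [NeZero N] (s : MaxTensor A B →ₗ[ℂ] ℂ)
    (α : MaxTensor A (Mat N) ≃⋆ₐ[ℂ] MaxTensor A (Mat N))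
    (β : MaxTensor B (Mat N) ≃⋆ₐ[ℂ] MaxTensor B (Mat N)) (φ : BiVec N) : Prop :=
  ∃ σ₀ σ, IsTensorVectorState s (ket00 N) σ₀ ∧ IsTensorVectorState s φ σ ∧
    ∀ X, σ₀ (MaxTensor.map (α : MaxTensor A (Mat N) →⋆ₐ[ℂ] MaxTensor A (Mat N))
      (β : MaxTensor B (Mat N) →⋆ₐ[ℂ] MaxTensor B (Mat N)) X) = σ X

/-- The *-automorphism `x ↦ (1 ⊗ U)⋆ x (1 ⊗ U)` of `A ⊗ M_N`, for a unitary matrix `U`. -/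
def rotate (U : Matrix.unitaryGroup (Fin N) ℂ) :
    MaxTensor A (Mat N) ≃⋆ₐ[ℂ] MaxTensor A (Mat N) :=
  (Unitary.conjStarAlgAut ℂ (MaxTensor A (Mat N))
    ⟨MaxTensor.inr (U : Mat N), Unitary.map_mem (MaxTensor.inr (A := A)) U.2⟩).symm

end Embezzlement

/-! ### The catalyst -/

/-- The Schmidt vectors of `2n`-qubit states with positive coefficients, whose squares are
rational. -/
def schmidtSet (n : ℕ+) : Set (EuclideanSpace ℝ (Fin (2 ^ (n : ℕ)))) :=
  {q | (∀ i, 0 < q i ∧ ∃ r : ℚ, q i ^ 2 = r) ∧ ∑ i, q i ^ 2 = 1}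

/-- The vector `∑ᵢ qᵢ |i⟩ ⊗ |i⟩`. -/
def schmidtVec {N : ℕ} (q : EuclideanSpace ℝ (Fin N)) : BiVec N :=
  WithLp.toLp 2 fun k => if k.1 = k.2 then (q k.1 : ℂ) else 0

/-- The registers: one for every `n ≥ 1` and every Schmidt vector in `schmidtSet n`. -/
abbrev Register : Type := Σ n : ℕ+, schmidtSet n

/-- The local dimension of a register. -/
abbrev Register.dim (r : Register) : ℕ := 2 ^ (r.1 : ℕ)

/-- The local algebra of Alice, and of Bob: the tensor product over all the registers `(n, q)` of
two-sided infinite chains of copies of `M_{2^n}`. -/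
abbrev CatalystAlgebra : Type := InfTensor fun x : Register × ℤ => x.1.dim

/-- The matrix `m` at position `i` of the chain of the register `r`. -/
def siteAt (r : Register) (i : ℤ) : Mat r.dim →⋆ₐ[ℂ] CatalystAlgebra :=
  InfTensor.site (d := fun x : Register × ℤ => x.1.dim) (r, i)

/-- The vector of the pair of sites, of Alice and of Bob, at position `i` of the register `r`. -/
def siteVec (r : Register) (i : ℤ) : BiVec r.dim :=
  if 0 < i then schmidtVec r.2.1 else ket00 r.dim

/-- `s` is the infinite tensor product of the vector states of `siteVec`. -/
structure IsCatalyst (s : MaxTensor CatalystAlgebra CatalystAlgebra →ₗ[ℂ] ℂ) : Prop where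
  isState : IsState s
  apply_prod : ∀ (F : List (Register × ℤ)), F.Nodup →
    ∀ a b : ∀ x : Register × ℤ, Mat x.1.dim,
      s (.tmul (F.map fun x => siteAt x.1 x.2 (a x)).prod
          (F.map fun x => siteAt x.1 x.2 (b x)).prod) =
        (F.map fun x => expect (siteVec x.1 x.2) (a x) (b x)).prod

/-- `α` is the shift of the chain of the register `r` by one position, after the swap of the
position `0` with the external system, and the identity on the other registers. -/
structure IsShiftSwap (r : Register)
    (α : MaxTensor CatalystAlgebra (Mat r.dim) ≃⋆ₐ[ℂ] MaxTensor CatalystAlgebra (Mat r.dim)) :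
    Prop where
  other : ∀ r' ≠ r, ∀ i m, α (.tmul (siteAt r' i m) 1) = .tmul (siteAt r' i m) 1
  shift : ∀ i ≠ 0, ∀ m, α (.tmul (siteAt r i m) 1) = .tmul (siteAt r (i + 1) m) 1
  swap_out : ∀ m, α (.tmul (siteAt r 0 m) 1) = .tmul 1 m
  swap_in : ∀ m, α (.tmul 1 m) = .tmul (siteAt r 1 m) 1

/-- The vector `(U ⊗ V) φ`. -/
def localUnitary {N : ℕ} (U V : Matrix.unitaryGroup (Fin N) ℂ) (φ : BiVec N) : BiVec N :=
  WithLp.toLp 2 (((U : Mat N) ⊗ₖ (V : Mat N)).mulVec φ.ofLp)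

/-- The target states in `ℂ^{2^n} ⊗ ℂ^{2^n}`: the vectors with a Schmidt vector in
`schmidtSet n`. -/
def targets (n : ℕ+) : Set (BiVec (2 ^ (n : ℕ))) :=
  {φ | ∃ q ∈ schmidtSet n, ∃ U V, φ = localUnitary U V (schmidtVec q)}

end

/-! The mechanism is Hilbert's hotel. In the chain of a register the pairs of sites at positions `i
≤ 0` are in the state |00⟩ and those at positions `i ≥ 1` in the state φ_q. Let both parties shift
their chains by one step, passing through the external system: 0 goes to the external factor, and
the external factor goes to 1. Pulling back s ⊗ s_00 gives each position `i ≠ 0` the vector of `i +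
1`, which is the same vector, gives position 0 the external |00⟩, and gives the external pair the
vector φ_q of position 1. The result is s ⊗ s_{φ_q} exactly (`expect_extVec_shiftPerm`). The local
unitaries only turn φ_q into (U ⊗ V)φ_q. The chains of different registers do not interact, so one
catalyst serves all targets.

The algebra rests on a universal property: *-homomorphisms of the site algebras with commuting
ranges extend uniquely to the infinite tensor product (`InfTensor.lift`, `InfTensor.hom_ext`).
Finitely many sites generate the image of one full matrix algebra; this is simple, so its
homomorphisms to nonzero C*-algebras are isometric, which makes the closed graph of the prescribed
map the graph of a contraction (`norm_snd_le_of_mem_graph`). The maximal tensor product has a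
universal property of the same kind. Hence bijections of the sites, an additional site, disjoint
unions and the splitting of M_{2^n} into n copies of M_2 all give *-isomorphisms. They provide the
shift automorphism, and they identify the catalyst algebra and its tensor square with the CAR
algebra.

A product of vector states exists because a unitary W_i whose zeroth column is the vector φ_i turns
the expectation value in φ_i into the (0,0) entry of W_i⋆ (m ⊗ m') W_i. The vector state of the
all-zero configuration, over sites of dimension d_i², multiplies such entries
(`exists_isProductState`). It is unique because states are continuous and the product elements are
total. Density of the targets follows from the Schmidt decomposition and from the density of
normalized rational weights in the probability simplex. -/

noncomputable section

open scoped Matrix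

/-! ### Homomorphisms of matrix algebras -/

/-- The reindexing of square matrices, as a *-isomorphism. -/
def Matrix.reindexStarAlgEquiv {m n : Type*} [Fintype m] [DecidableEq m] [Fintype n]
    [DecidableEq n] (e : m ≃ n) : Matrix m m ℂ ≃⋆ₐ[ℂ] Matrix n n ℂ :=
  .ofAlgEquiv (Matrix.reindexAlgEquiv ℂ ℂ e) fun _ => rfl

/-- The scalar matrices of size one, mapped to the multiples of the identity. -/
def Matrix.scalarHom (n : Type*) [Unique n] [Fintype n] [DecidableEq n] (D : Type*)
    [CStarAlgebra D] : Matrix n n ℂ →⋆ₐ[ℂ] D where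
  toFun x := algebraMap ℂ D (x default default)
  map_one' := by simp
  map_mul' x y := by simp [Matrix.mul_apply]
  map_zero' := by simp
  map_add' x y := by simp
  commutes' c := by simp [Matrix.algebraMap_matrix_apply]
  map_star' x := algebraMap_star_comm _

section MatrixHom

variable {m n : Type*} [Fintype m] [DecidableEq m] [Fintype n] [DecidableEq n]
  {D : Type*} [CStarAlgebra D]

/-- The *-homomorphism `x ⊗ y ↦ f x * g y` of the Kronecker product. -/
def Matrix.kroneckerLift (f : Matrix m m ℂ →⋆ₐ[ℂ] D) (g : Matrix n n ℂ →⋆ₐ[ℂ] D)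
    (h : ∀ x y, Commute (f x) (g y)) : Matrix (m × n) (m × n) ℂ →⋆ₐ[ℂ] D :=
  (MaxTensor.algLift f g h).comp
    ((Matrix.kroneckerStarAlgEquiv m n ℂ).symm : Matrix (m × n) (m × n) ℂ →⋆ₐ[ℂ] _)

theorem Matrix.kroneckerLift_kronecker (f : Matrix m m ℂ →⋆ₐ[ℂ] D) (g : Matrix n n ℂ →⋆ₐ[ℂ] D)
    (h : ∀ x y, Commute (f x) (g y)) (x : Matrix m m ℂ) (y : Matrix n n ℂ) :
    Matrix.kroneckerLift f g h (x ⊗ₖ y) = f x * g y := by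
  have : (Matrix.kroneckerStarAlgEquiv m n ℂ).symm (x ⊗ₖ y) = x ⊗ₜ y := by
    rw [StarAlgEquiv.symm_apply_eq]
    simp
  change MaxTensor.algLift f g h ((Matrix.kroneckerStarAlgEquiv m n ℂ).symm (x ⊗ₖ y)) = _
  rw [this]
  rfl

theorem Matrix.commute_kroneckerLift (f : Matrix m m ℂ →⋆ₐ[ℂ] D) (g : Matrix n n ℂ →⋆ₐ[ℂ] D)
    (h : ∀ x y, Commute (f x) (g y)) {c : D} (hf : ∀ x, Commute (f x) c)
    (hg : ∀ y, Commute (g y) c) (z : Matrix (m × n) (m × n) ℂ) :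
    Commute (Matrix.kroneckerLift f g h z) c := by
  change Commute (MaxTensor.algLift f g h ((Matrix.kroneckerStarAlgEquiv m n ℂ).symm z)) c
  generalize (Matrix.kroneckerStarAlgEquiv m n ℂ).symm z = t
  induction t with
  | zero => simp
  | tmul x y => exact (hf x).mul_left (hg y)
  | add x y hx hy => rw [map_add]; exact hx.add_left hy

/-- A full matrix algebra is simple, so a unital homomorphism to a nonzero algebra is injective, and
injective *-homomorphisms of C*-algebras are isometric. -/
theorem Matrix.norm_starAlgHom_apply [Nonempty n] [Nontrivial D] (f : Matrix n n ℂ →⋆ₐ[ℂ] D)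
    (x : Matrix n n ℂ) : ‖f x‖ = ‖x‖ :=
  NonUnitalStarAlgHom.norm_map f (f : Matrix n n ℂ →+* D).injective x

end MatrixHom

theorem StarAlgHom.continuous_of_cstarAlgebra {A B : Type*} [CStarAlgebra A] [CStarAlgebra B]
    (f : A →⋆ₐ[ℂ] B) : Continuous f :=
  AddMonoidHomClass.continuous_of_bound f 1 fun x => by
    simpa using NonUnitalStarAlgHom.norm_apply_le f x

/-! ### Commuting families of matrix algebras and their finite subfamilies. -/

section CommutingFamily

variable {ι : Type*} {d : ι → ℕ} {D : Type*} [CStarAlgebra D]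

/-- The ranges of the *-homomorphisms `g i` commute with each other. -/
def CommutingFamily (g : ∀ i, Mat (d i) →⋆ₐ[ℂ] D) : Prop :=
  ∀ i j, i ≠ j → ∀ x y, Commute (g i x) (g j y)

/-- Sites are added one at a time through the Kronecker product. The second property of `h` carries
the induction: it makes the range of `h` commute with the range of the next `g j`, as the Kronecker
lift requires. -/
theorem CommutingFamily.exists_matrixHom {g : ∀ i, Mat (d i) →⋆ₐ[ℂ] D} (hg : CommutingFamily g)
    (F : Finset ι) : ∃ h : Mat (∏ i ∈ F, d i) →⋆ₐ[ℂ] D,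
      (∀ i ∈ F, ∀ x, g i x ∈ h.range) ∧
      ∀ c, (∀ i ∈ F, ∀ x, Commute (g i x) c) → ∀ x, Commute (h x) c := by
  classical
  induction F using Finset.induction_on with
  | empty =>
    have : Unique (Fin (∏ i ∈ (∅ : Finset ι), d i)) := by
      rw [Finset.prod_empty]; infer_instance
    exact ⟨Matrix.scalarHom _ D, by simp, fun c _ x => Algebra.commutes _ _⟩
  | insert j F hj ih =>
    obtain ⟨h, hr, hc⟩ := ih
    have hcomm : ∀ x y, Commute (g j x) (h y) := fun x y =>
      (hc (g j x) (fun i hi z => hg i j (fun e => hj (e ▸ hi)) z x) y).symm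
    let e : Fin (d j) × Fin (∏ i ∈ F, d i) ≃ Fin (∏ i ∈ insert j F, d i) :=
      finProdFinEquiv.trans (finCongr (Finset.prod_insert hj).symm)
    let r := Matrix.reindexStarAlgEquiv e
    refine ⟨(Matrix.kroneckerLift (g j) h hcomm).comp (r.symm : _ →⋆ₐ[ℂ] _), ?_, ?_⟩
    · have key : ∀ x y, g j x * h y ∈
          ((Matrix.kroneckerLift (g j) h hcomm).comp (r.symm : _ →⋆ₐ[ℂ] _)).range := fun x y =>
        ⟨r (x ⊗ₖ y), by
          change Matrix.kroneckerLift (g j) h hcomm (r.symm (r (x ⊗ₖ y))) = _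
          rw [StarAlgEquiv.symm_apply_apply, Matrix.kroneckerLift_kronecker]⟩
      intro i hi x
      rcases Finset.mem_insert.1 hi with rfl | hi
      · simpa using key x 1
      · obtain ⟨y, hy⟩ := hr i hi x
        have hy' : h y = g i x := hy
        simpa [hy'] using key 1 y
    · intro c hcc x
      exact Matrix.commute_kroneckerLift _ _ hcomm (hcc j (Finset.mem_insert_self j F))
        (hc c fun i hi => hcc i (Finset.mem_insert_of_mem hi)) _

/-- A *-polynomial involves only finitely many sites. Quantifying over all the *-subalgebras `h`
lets the result apply both to the range of a matrix homomorphism and to the span of the product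
elements. -/
theorem exists_finset_of_mem_adjoin {g : ∀ i, Mat (d i) →⋆ₐ[ℂ] D} {x : D}
    (hx : x ∈ StarAlgebra.adjoin ℂ (⋃ i, Set.range (g i))) :
    ∃ F : Finset ι, ∀ h : StarSubalgebra ℂ D, (∀ i ∈ F, ∀ x, g i x ∈ h) → x ∈ h := by
  classical
  induction hx using StarAlgebra.adjoin_induction with
  | mem x hx =>
    obtain ⟨i, m, rfl⟩ := Set.mem_iUnion.1 hx
    exact ⟨{i}, fun h hh => hh i (Finset.mem_singleton_self i) m⟩
  | algebraMap c => exact ⟨∅, fun h _ => algebraMap_mem h c⟩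
  | add x y _ _ hx hy =>
    obtain ⟨F, hF⟩ := hx
    obtain ⟨G, hG⟩ := hy
    exact ⟨F ∪ G, fun h hh => add_mem (hF h fun i hi => hh i (Finset.mem_union_left _ hi))
      (hG h fun i hi => hh i (Finset.mem_union_right _ hi))⟩
  | mul x y _ _ hx hy =>
    obtain ⟨F, hF⟩ := hx
    obtain ⟨G, hG⟩ := hy
    exact ⟨F ∪ G, fun h hh => mul_mem (hF h fun i hi => hh i (Finset.mem_union_left _ hi))
      (hG h fun i hi => hh i (Finset.mem_union_right _ hi))⟩
  | star x _ hx =>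
    obtain ⟨F, hF⟩ := hx
    exact ⟨F, fun h hh => star_mem (hF h hh)⟩

end CommutingFamily

/-! ### Generators of the infinite tensor product. -/

namespace InfTensor

variable {ι : Type*} {d : ι → ℕ}

theorem flip_comm {i j : ι} (h : i ≠ j) (k l : Fin (d i)) (k' l' : Fin (d j)) (x : Config d) :
    flip i k l (flip j k' l' x) = flip j k' l' (flip i k l x) := by
  classical
  simp only [flip, Equiv.coe_fn_mk]
  rw [Function.update_of_ne h, Function.update_of_ne h.symm, Function.update_comm h]

theorem flip_apply_of_ne {i j : ι} (h : j ≠ i) (k l : Fin (d i)) (x : Config d) :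
    flip i k l x j = x j := by
  classical
  simp [flip, Function.update_of_ne h]

theorem commute_matrixUnit {i j : ι} (h : i ≠ j) (k l : Fin (d i)) (k' l' : Fin (d j)) :
    Commute (matrixUnit i k l) (matrixUnit j k' l') := by
  refine ContinuousLinearMap.ext fun f => lp.ext <| funext fun x => ?_
  change matrixUnit i k l (matrixUnit j k' l' f) x = matrixUnit j k' l' (matrixUnit i k l f) x
  simp only [matrixUnit_apply, flip_apply_of_ne h, flip_apply_of_ne h.symm, flip_comm h]
  split_ifs <;> rfl

theorem commute_siteRep {i j : ι} (h : i ≠ j) (x : Mat (d i)) (y : Mat (d j)) :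
    Commute (siteRep i x) (siteRep j y) := by
  change Commute (∑ k, ∑ l, x k l • matrixUnit i k l) (∑ k, ∑ l, y k l • matrixUnit j k l)
  refine Commute.sum_left _ _ _ fun k _ => Commute.sum_left _ _ _ fun l _ =>
    Commute.sum_right _ _ _ fun k' _ => Commute.sum_right _ _ _ fun l' _ => ?_
  exact ((commute_matrixUnit h k l k' l').smul_left _).smul_right _

theorem commutingFamily_site : CommutingFamily (site (d := d)) :=
  fun _ _ h x y => Subtype.ext (commute_siteRep h x y)

theorem dense_adjoin_site :
    Dense (StarAlgebra.adjoin ℂ (⋃ i, Set.range (site (d := d) i)) : Set (InfTensor d)) := by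
  intro x
  let φ : InfTensor d →⋆ₐ[ℂ] (Hilb d →L[ℂ] Hilb d) := (InfTensor.subalgebra d).subtype
  have hmap : (StarAlgebra.adjoin ℂ (⋃ i, Set.range (site (d := d) i))).map φ =
      StarAlgebra.adjoin ℂ (⋃ i, Set.range (siteRep (d := d) i)) := by
    rw [StarAlgHom.map_adjoin, Set.image_iUnion]
    congr 1
    refine Set.iUnion_congr fun i => ?_
    rw [← Set.range_comp]
    rfl
  have hx : φ x ∈ closure (φ '' (StarAlgebra.adjoin ℂ (⋃ i, Set.range (site (d := d) i)))) := by
    have h : φ x ∈ InfTensor.subalgebra d := Subtype.prop x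
    rw [InfTensor.subalgebra, ← hmap] at h
    exact h
  exact closure_subtype.2 hx

/-- Properties of all the elements of an infinite tensor product. -/
theorem induction {P : InfTensor d → Prop} (hc : IsClosed {x | P x}) (site : ∀ i m, P (site i m))
    (algebraMap : ∀ c, P (algebraMap ℂ _ c)) (add : ∀ x y, P x → P y → P (x + y))
    (mul : ∀ x y, P x → P y → P (x * y)) (x : InfTensor d) : P x := by
  refine hc.closure_subset_iff.2 ?_ (dense_adjoin_site x)
  intro y hy
  change y ∈ (StarAlgebra.adjoin ℂ _).toSubalgebra at hy
  -- The *-algebra is the plain algebra generated by the site matrices and their adjoints. The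
  -- adjoint of a site matrix is again a site matrix, so no closure of `P` under `star` is needed.
  rw [StarAlgebra.adjoin_toSubalgebra] at hy
  refine Algebra.adjoin_induction (p := fun x _ => P x) ?_ algebraMap
    (fun x y _ _ => add x y) (fun x y _ _ => mul x y) hy
  rintro z (hz | hz)
  · obtain ⟨i, m, rfl⟩ := Set.mem_iUnion.1 hz
    exact site i m
  · obtain ⟨i, m, hm⟩ := Set.mem_iUnion.1 hz
    have : z = InfTensor.site i (star m) := by rw [map_star, hm, star_star]
    exact this ▸ site i _

theorem hom_ext {C : Type*} [CStarAlgebra C] {f g : InfTensor d →⋆ₐ[ℂ] C}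
    (h : ∀ i m, f (site i m) = g (site i m)) : f = g := by
  refine StarAlgHom.ext fun x => induction (P := fun x => f x = g x) (isClosed_eq
    f.continuous_of_cstarAlgebra g.continuous_of_cstarAlgebra) h (fun c => ?_)
    (fun x y hx hy => ?_) (fun x y hx hy => ?_) x
  · simp [AlgHomClass.commutes]
  · rw [map_add, map_add, hx, hy]
  · rw [map_mul, map_mul, hx, hy]

theorem commute_hom {C : Type*} [CStarAlgebra C] (f : InfTensor d →⋆ₐ[ℂ] C) {c : C}
    (h : ∀ i m, Commute (f (site i m)) c) (x : InfTensor d) : Commute (f x) c := by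
  have hf := f.continuous_of_cstarAlgebra
  refine induction (P := fun x => Commute (f x) c) (isClosed_eq (by fun_prop) (by fun_prop)) h
    (fun r => ?_) (fun x y hx hy => ?_) (fun x y hx hy => ?_) x
  · rw [AlgHomClass.commutes]
    exact Algebra.commutes _ _
  · rw [map_add]; exact hx.add_left hy
  · rw [map_mul]; exact hx.mul_left hy

instance [∀ i, NeZero (d i)] : Nontrivial (InfTensor d) := by
  classical
  refine ⟨⟨1, 0, fun h => ?_⟩⟩
  have h1 : (1 : Hilb d →L[ℂ] Hilb d) = 0 := congrArg Subtype.val h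
  have h2 := congrArg (fun T : Hilb d →L[ℂ] Hilb d =>
    T (lp.single 2 (fun _ => 0) (1 : ℂ)) (fun _ => 0)) h1
  simp at h2

/-! ### The universal property of the infinite tensor product. -/

section Lift

variable {C : Type*} [CStarAlgebra C] (f : ∀ i, Mat (d i) →⋆ₐ[ℂ] C)

/-- The graph of the *-homomorphism that extends all the `f i`. -/
def graph : StarSubalgebra ℂ (InfTensor d × C) :=
  (StarAlgebra.adjoin ℂ (⋃ i, Set.range ((site (d := d) i).prod (f i)))).topologicalClosure

theorem mem_graph (i : ι) (m : Mat (d i)) : (site i m, f i m) ∈ graph f :=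
  StarSubalgebra.le_topologicalClosure _
    (StarAlgebra.subset_adjoin ℂ _ (Set.mem_iUnion.2 ⟨i, m, rfl⟩))

variable {f}

theorem star_mem_graph {x : InfTensor d} {y : C} (h : (x, y) ∈ graph f) :
    (star x, star y) ∈ graph f := by
  have := star_mem h
  rwa [Prod.star_def] at this

variable [∀ i, NeZero (d i)]

/-- The estimate is closed, so it suffices on the *-algebra generated by the pairs `(site i m, f i
m)`. There `z = h x` for a single matrix `x`. The first component of `h` is isometric by simplicity,
the second is contractive, hence ‖z.2‖ ≤ ‖x‖ = ‖z.1‖. -/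
theorem norm_snd_le_of_mem_graph (hf : CommutingFamily f) {z : InfTensor d × C}
    (hz : z ∈ graph f) : ‖z.2‖ ≤ ‖z.1‖ := by
  have hcl : IsClosed {z : InfTensor d × C | ‖z.2‖ ≤ ‖z.1‖} :=
    isClosed_le (by fun_prop) (by fun_prop)
  refine hcl.closure_subset_iff.2 (fun z hz => ?_) hz
  have hg : CommutingFamily fun i => (site (d := d) i).prod (f i) := fun i j h x y =>
    Prod.ext (commutingFamily_site i j h x y) (hf i j h x y)
  obtain ⟨F, hF⟩ := exists_finset_of_mem_adjoin hz
  obtain ⟨h, hr, -⟩ := hg.exists_matrixHom F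
  obtain ⟨x, hx⟩ := hF h.range hr
  have hx : h x = z := hx
  -- Simplicity fails for matrices of size zero; the hypothesis that all the `d i` are nonzero
  -- excludes them.
  have : Nonempty (Fin (∏ i ∈ F, d i)) :=
    Fin.pos_iff_nonempty.1 (Finset.prod_pos fun i _ => Nat.pos_of_neZero (d i))
  have h1 : ‖z.1‖ = ‖x‖ := by
    rw [← hx]
    exact Matrix.norm_starAlgHom_apply ((StarAlgHom.fst ℂ (InfTensor d) C).comp h) x
  have h2 : ‖z.2‖ ≤ ‖x‖ := by
    rw [← hx]
    exact NonUnitalStarAlgHom.norm_apply_le ((StarAlgHom.snd ℂ (InfTensor d) C).comp h) x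
  exact h2.trans h1.ge

/-- The norm of a pair is the maximum of the two norms, so by the previous estimate the projection
of the graph to its first component is isometric. Its range is complete, hence closed, and contains
the dense *-algebra of the sites. -/
theorem exists_mem_graph (hf : CommutingFamily f) (x : InfTensor d) :
    ∃ y, (x, y) ∈ graph f := by
  have : CompleteSpace (graph f) :=
    (StarSubalgebra.isClosed_topologicalClosure _).completeSpace_coe
  let p : graph f →⋆ₐ[ℂ] InfTensor d := (StarAlgHom.fst ℂ (InfTensor d) C).comp (graph f).subtype
  have hp : Isometry p := AddMonoidHomClass.isometry_of_norm p fun z =>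
    (max_eq_left (norm_snd_le_of_mem_graph hf z.2)).symm
  have hcl : IsClosed (Set.range p) := hp.isClosedEmbedding.isClosed_range
  have hle : (StarAlgebra.adjoin ℂ (⋃ i, Set.range (site (d := d) i))) ≤ p.range := by
    refine StarAlgebra.adjoin_le (Set.iUnion_subset fun i => ?_)
    rintro _ ⟨m, rfl⟩
    exact ⟨⟨_, mem_graph f i m⟩, rfl⟩
  obtain ⟨⟨⟨a, y⟩, hz⟩, rfl⟩ := hcl.closure_subset_iff.2 hle (dense_adjoin_site x)
  exact ⟨y, hz⟩

theorem eq_of_mem_graph (hf : CommutingFamily f) {x : InfTensor d} {y y' : C}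
    (h : (x, y) ∈ graph f) (h' : (x, y') ∈ graph f) : y = y' := by
  have := norm_snd_le_of_mem_graph hf (sub_mem h h')
  simpa [sub_eq_zero] using this

/-- Universal property of the infinite tensor product: *-homomorphisms of the matrix algebras of
all the sites, with commuting ranges, extend to a *-homomorphism. -/
def lift (hf : CommutingFamily f) : InfTensor d →⋆ₐ[ℂ] C where
  toFun x := (exists_mem_graph hf x).choose
  map_one' := eq_of_mem_graph hf (exists_mem_graph hf 1).choose_spec (one_mem (graph f))
  map_mul' x y := eq_of_mem_graph hf (exists_mem_graph hf _).choose_spec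
    (mul_mem (exists_mem_graph hf x).choose_spec (exists_mem_graph hf y).choose_spec)
  map_zero' := eq_of_mem_graph hf (exists_mem_graph hf 0).choose_spec (zero_mem (graph f))
  map_add' x y := eq_of_mem_graph hf (exists_mem_graph hf _).choose_spec
    (add_mem (exists_mem_graph hf x).choose_spec (exists_mem_graph hf y).choose_spec)
  commutes' c := eq_of_mem_graph hf (exists_mem_graph hf _).choose_spec
    (algebraMap_mem (graph f) c)
  map_star' x := eq_of_mem_graph hf (exists_mem_graph hf _).choose_spec
    (star_mem_graph (exists_mem_graph hf x).choose_spec)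

theorem lift_site (hf : CommutingFamily f) (i : ι) (m : Mat (d i)) :
    lift hf (site i m) = f i m :=
  eq_of_mem_graph hf (exists_mem_graph hf _).choose_spec (mem_graph f i m)

end Lift

end InfTensor

/-! ### Calculus of the maximal tensor product. -/

namespace MaxTensor

variable {A B C A' B' : Type*} [CStarAlgebra A] [CStarAlgebra B] [CStarAlgebra C]
  [CStarAlgebra A'] [CStarAlgebra B']

theorem inl_apply (a : A) : (inl a : MaxTensor A B) = tmul a 1 := rfl

theorem inr_apply (b : B) : (inr b : MaxTensor A B) = tmul 1 b := rfl

theorem tmul_mul_tmul (a a' : A) (b b' : B) :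
    tmul a b * tmul a' b' = tmul (a * a') (b * b') := by
  simp only [tmul]
  rw [← map_mul, Algebra.TensorProduct.tmul_mul_tmul]

theorem inl_mul_inr (a : A) (b : B) : (inl a * inr b : MaxTensor A B) = tmul a b := by
  rw [inl_apply, inr_apply, tmul_mul_tmul, mul_one, one_mul]

/-- Properties of all the elements of a maximal tensor product. -/
theorem induction {P : MaxTensor A B → Prop} (hc : IsClosed {x | P x})
    (tmul : ∀ a b, P (tmul a b)) (add : ∀ x y, P x → P y → P (x + y)) (x : MaxTensor A B) :
    P x := by
  refine CStarSeminorm.Completion.ind (maxSeminorm A B) x hc fun t => ?_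
  change P (ofAlg t)
  induction t with
  | zero => simpa [MaxTensor.tmul] using tmul 0 0
  | tmul a b => exact tmul a b
  | add x y hx hy => rw [map_add]; exact add _ _ hx hy

theorem hom_ext {f g : MaxTensor A B →⋆ₐ[ℂ] C} (hl : ∀ a, f (inl a) = g (inl a))
    (hr : ∀ b, f (inr b) = g (inr b)) : f = g := by
  refine StarAlgHom.ext fun x => induction (P := fun x => f x = g x) (isClosed_eq
    f.continuous_of_cstarAlgebra g.continuous_of_cstarAlgebra) (fun a b => ?_)
    (fun x y hx hy => ?_) x
  · rw [← inl_mul_inr, map_mul, map_mul, hl, hr]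
  · rw [map_add, map_add, hx, hy]

theorem lift_inl (f : A →⋆ₐ[ℂ] C) (g : B →⋆ₐ[ℂ] C) (h : ∀ a b, Commute (f a) (g b)) (a : A) :
    lift f g h (inl a) = f a := by
  rw [inl_apply, lift_tmul, map_one, mul_one]

theorem lift_inr (f : A →⋆ₐ[ℂ] C) (g : B →⋆ₐ[ℂ] C) (h : ∀ a b, Commute (f a) (g b)) (b : B) :
    lift f g h (inr b) = g b := by
  rw [inr_apply, lift_tmul, map_one, one_mul]

theorem map_tmul (f : A →⋆ₐ[ℂ] A') (g : B →⋆ₐ[ℂ] B') (a : A) (b : B) :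
    map f g (tmul a b) = tmul (f a) (g b) := by
  exact (lift_tmul _ _ _ a b).trans (inl_mul_inr _ _)

theorem continuous_inl : Continuous (inl : A →⋆ₐ[ℂ] MaxTensor A B) :=
  StarAlgHom.continuous_of_cstarAlgebra _

theorem continuous_inr : Continuous (inr : B →⋆ₐ[ℂ] MaxTensor A B) :=
  StarAlgHom.continuous_of_cstarAlgebra _

theorem continuous_tmul_left (b : B) : Continuous fun a : A => tmul a b := by
  simp only [← inl_mul_inr]
  exact continuous_inl.mul continuous_const

theorem continuous_tmul_right (a : A) : Continuous fun b : B => tmul a b := by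
  simp only [← inl_mul_inr]
  exact continuous_const.mul continuous_inr

theorem add_tmul (a a' : A) (b : B) : tmul (a + a') b = tmul a b + tmul a' b := by
  simp only [← inl_mul_inr, map_add, add_mul]

theorem tmul_add (a : A) (b b' : B) : tmul a (b + b') = tmul a b + tmul a b' := by
  simp only [← inl_mul_inr, map_add, mul_add]

theorem smul_tmul (c : ℂ) (a : A) (b : B) : tmul (c • a) b = c • tmul a b := by
  simp only [← inl_mul_inr, map_smul, smul_mul_assoc]

theorem tmul_smul (c : ℂ) (a : A) (b : B) : tmul a (c • b) = c • tmul a b := by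
  simp only [← inl_mul_inr, map_smul, mul_smul_comm]

end MaxTensor

/-! ### Isomorphisms obtained by rearranging the sites. -/

namespace InfTensor

variable {ι κ : Type*} {d : ι → ℕ} {d' : κ → ℕ}

/-- Matrices of equal sizes. -/
def castMat {N N' : ℕ} (h : N = N') : Mat N ≃⋆ₐ[ℂ] Mat N' := h ▸ StarAlgEquiv.refl ℂ (Mat N)

theorem castMat_castMat {N N' N'' : ℕ} (h : N = N') (h' : N' = N'') (m : Mat N) :
    castMat h' (castMat h m) = castMat (h.trans h') m := by
  subst h h'
  rfl

/-- Both sites are variables, so that their equality can be eliminated; it is applied to identities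
such as `e.symm (e i) = i`, which need not hold definitionally. -/
theorem site_castMat {i j : ι} (hij : i = j) (h : d j = d i) (m : Mat (d j)) :
    site i (castMat h m) = site j m := by
  subst hij
  rfl

theorem commutingFamily_site_comp {f : ι → κ} (hf : Function.Injective f)
    (h : ∀ i, d i = d' (f i)) : CommutingFamily fun i =>
    (site (d := d') (f i)).comp (castMat (h i) : Mat (d i) →⋆ₐ[ℂ] Mat (d' (f i))) :=
  fun i j hij _ _ => commutingFamily_site (f i) (f j) (hf.ne hij) _ _

section Incl

variable [∀ i, NeZero (d i)] {f : ι → κ} (hf : Function.Injective f) (h : ∀ i, d i = d' (f i))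

/-- The *-homomorphism of an injective map of the sites. -/
def inclHom : InfTensor d →⋆ₐ[ℂ] InfTensor d' := lift (commutingFamily_site_comp hf h)

theorem inclHom_site (i : ι) (m : Mat (d i)) :
    inclHom hf h (site i m) = site (f i) (castMat (h i) m) := lift_site _ i m

end Incl

instance [∀ i, NeZero (d i)] [∀ i, NeZero (d' i)] (x : ι ⊕ κ) : NeZero (Sum.elim d d' x) := by
  cases x <;> (dsimp; infer_instance)

section Prod

/-- The family of the sites of both factors of a tensor product. -/
def sumSite (x : ι ⊕ κ) : Mat (Sum.elim d d' x) →⋆ₐ[ℂ] MaxTensor (InfTensor d) (InfTensor d') :=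
  match x with
  | .inl i => MaxTensor.inl.comp (site i)
  | .inr k => MaxTensor.inr.comp (site k)

theorem commutingFamily_sumSite : CommutingFamily (sumSite (d := d) (d' := d')) := by
  rintro (i | i) (j | j) h x y
  · exact (commutingFamily_site i j (fun e => h (e ▸ rfl)) x y).map
      (MaxTensor.inl : _ →⋆ₐ[ℂ] MaxTensor (InfTensor d) (InfTensor d'))
  · exact MaxTensor.commute_inl_inr _ _
  · exact (MaxTensor.commute_inl_inr _ _).symm
  · exact (commutingFamily_site i j (fun e => h (e ▸ rfl)) x y).map
      (MaxTensor.inr : _ →⋆ₐ[ℂ] MaxTensor (InfTensor d) (InfTensor d'))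

/-- The inclusion of the left sites. -/
def leftHom [∀ i, NeZero (d i)] : InfTensor d →⋆ₐ[ℂ] InfTensor (Sum.elim d d') :=
  inclHom Sum.inl_injective fun _ => rfl

/-- The inclusion of the right sites. -/
def rightHom [∀ i, NeZero (d' i)] : InfTensor d' →⋆ₐ[ℂ] InfTensor (Sum.elim d d') :=
  inclHom Sum.inr_injective fun _ => rfl

theorem leftHom_site [∀ i, NeZero (d i)] (i : ι) (m : Mat (d i)) :
    leftHom (d' := d') (site i m) = site (d := Sum.elim d d') (Sum.inl i) m := inclHom_site _ _ i m

theorem rightHom_site [∀ i, NeZero (d' i)] (i : κ) (m : Mat (d' i)) :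
    rightHom (d := d) (site i m) = site (d := Sum.elim d d') (Sum.inr i) m := inclHom_site _ _ i m

variable [∀ i, NeZero (d i)] [∀ i, NeZero (d' i)]

theorem commute_leftHom_rightHom (a : InfTensor d) (b : InfTensor d') :
    Commute (leftHom (d' := d') a) (rightHom (d := d) b) := by
  refine commute_hom _ (fun i m => ?_) a
  refine (commute_hom _ (fun j m' => ?_) b).symm
  rw [leftHom_site, rightHom_site]
  exact commutingFamily_site _ _ Sum.inr_ne_inl _ _

/-- The tensor product of two infinite tensor products is the infinite tensor product over the
disjoint union of the sites. -/
def sumEquiv : MaxTensor (InfTensor d) (InfTensor d') ≃⋆ₐ[ℂ] InfTensor (Sum.elim d d') :=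
  -- Each direction comes from the universal property of its source. The two composites are
  -- identities because they fix every site.
  .ofStarAlgHom (MaxTensor.lift leftHom rightHom commute_leftHom_rightHom)
    (lift commutingFamily_sumSite)
    (by
      refine MaxTensor.hom_ext (fun a => ?_) fun b => ?_
      · change ((lift commutingFamily_sumSite).comp
          ((MaxTensor.lift leftHom rightHom commute_leftHom_rightHom).comp MaxTensor.inl)) a = _
        revert a
        refine fun a => DFunLike.congr_fun (g := MaxTensor.inl) (hom_ext fun i m => ?_) a
        simp only [StarAlgHom.comp_apply, MaxTensor.lift_inl, leftHom_site]
        exact lift_site commutingFamily_sumSite (Sum.inl i) m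
      · change ((lift commutingFamily_sumSite).comp
          ((MaxTensor.lift leftHom rightHom commute_leftHom_rightHom).comp MaxTensor.inr)) b = _
        refine DFunLike.congr_fun (g := MaxTensor.inr) (hom_ext fun i m => ?_) b
        simp only [StarAlgHom.comp_apply, MaxTensor.lift_inr, rightHom_site]
        exact lift_site commutingFamily_sumSite (Sum.inr i) m)
    (by
      refine hom_ext ?_
      rintro (i | i) m
      · rw [StarAlgHom.comp_apply, lift_site]
        exact (MaxTensor.lift_inl _ _ _ _).trans (leftHom_site i m)
      · rw [StarAlgHom.comp_apply, lift_site]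
        exact (MaxTensor.lift_inr _ _ _ _).trans (rightHom_site i m))

end Prod

section Option

/-- The local dimensions, with an additional site of dimension `N`. -/
def optionDim (d : ι → ℕ) (N : ℕ) : Option ι → ℕ
  | none => N
  | some i => d i

variable (d) (N : ℕ)

instance [NeZero N] [∀ i, NeZero (d i)] (x : Option ι) : NeZero (optionDim d N x) := by
  cases x <;> (dsimp [optionDim]; infer_instance)

/-- The sites of an infinite tensor product, and an external matrix algebra. -/
def optionSite (x : Option ι) : Mat (optionDim d N x) →⋆ₐ[ℂ] MaxTensor (InfTensor d) (Mat N) :=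
  match x with
  | none => MaxTensor.inr
  | some i => MaxTensor.inl.comp (site i)

theorem commutingFamily_optionSite : CommutingFamily (optionSite d N) := by
  rintro (_ | i) (_ | j) h x y
  · exact absurd rfl h
  · exact (MaxTensor.commute_inl_inr _ _).symm
  · exact MaxTensor.commute_inl_inr _ _
  · exact (commutingFamily_site i j (fun e => h (e ▸ rfl)) x y).map
      (MaxTensor.inl : _ →⋆ₐ[ℂ] MaxTensor (InfTensor d) (Mat N))

variable [∀ i, NeZero (d i)]

/-- The inclusion of the sites other than the external one. -/
def someHom : InfTensor d →⋆ₐ[ℂ] InfTensor (optionDim d N) :=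
  inclHom (Option.some_injective ι) fun _ => rfl

theorem someHom_site (i : ι) (m : Mat (d i)) :
    someHom d N (site i m) = site (d := optionDim d N) (some i) m := inclHom_site _ _ i m

/-- The inclusion of the external site. -/
def noneHom : Mat N →⋆ₐ[ℂ] InfTensor (optionDim d N) := site (d := optionDim d N) none

theorem commute_someHom_noneHom (a : InfTensor d) (m : Mat N) :
    Commute (someHom d N a) (noneHom d N m) := by
  refine commute_hom _ (fun i m => ?_) a
  rw [someHom_site]
  exact commutingFamily_site _ _ (Option.some_ne_none i) _ _

/-- The *-homomorphism that identifies the external matrix algebra with an additional site. -/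
def optionHom : MaxTensor (InfTensor d) (Mat N) →⋆ₐ[ℂ] InfTensor (optionDim d N) :=
  MaxTensor.lift (someHom d N) (noneHom d N) (commute_someHom_noneHom d N)

theorem optionHom_inl_site (i : ι) (m : Mat (d i)) :
    optionHom d N (MaxTensor.inl (site i m)) = site (d := optionDim d N) (some i) m :=
  (MaxTensor.lift_inl _ _ _ _).trans (someHom_site d N i m)

theorem optionHom_inr (m : Mat N) :
    optionHom d N (MaxTensor.inr m) = site (d := optionDim d N) none m :=
  MaxTensor.lift_inr _ _ _ _

variable [NeZero N]

/-- An infinite tensor product with an additional site. -/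
def optionEquiv : MaxTensor (InfTensor d) (Mat N) ≃⋆ₐ[ℂ] InfTensor (optionDim d N) :=
  .ofStarAlgHom (optionHom d N) (lift (commutingFamily_optionSite d N))
    (by
      refine MaxTensor.hom_ext (fun a => ?_) fun b => ?_
      · change ((lift (commutingFamily_optionSite d N)).comp
          ((optionHom d N).comp MaxTensor.inl)) a = _
        refine DFunLike.congr_fun (g := MaxTensor.inl) (hom_ext fun i m => ?_) a
        rw [StarAlgHom.comp_apply, StarAlgHom.comp_apply, optionHom_inl_site]
        exact lift_site (commutingFamily_optionSite d N) (some i) m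
      · rw [StarAlgHom.comp_apply, optionHom_inr]
        exact lift_site (commutingFamily_optionSite d N) none b)
    (by
      refine hom_ext ?_
      rintro (_ | i) m
      · rw [StarAlgHom.comp_apply, lift_site]
        exact optionHom_inr d N m
      · rw [StarAlgHom.comp_apply, lift_site]
        exact optionHom_inl_site d N i m)

theorem optionEquiv_inl_site (i : ι) (m : Mat (d i)) :
    optionEquiv d N (MaxTensor.inl (site i m)) = site (d := optionDim d N) (some i) m :=
  optionHom_inl_site d N i m

theorem optionEquiv_inr (m : Mat N) :
    optionEquiv d N (MaxTensor.inr m) = site (d := optionDim d N) none m :=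
  optionHom_inr d N m

end Option

section Congr

theorem dim_symm (e : ι ≃ κ) (h : ∀ i, d i = d' (e i)) (k : κ) : d' k = d (e.symm k) := by
  rw [h, e.apply_symm_apply]

variable [∀ i, NeZero (d i)] [∀ i, NeZero (d' i)] (e : ι ≃ κ) (h : ∀ i, d i = d' (e i))

/-- The *-isomorphism of a bijection of the sites. -/
def congr : InfTensor d ≃⋆ₐ[ℂ] InfTensor d' :=
  .ofStarAlgHom (inclHom e.injective h) (inclHom e.symm.injective (dim_symm e h))
    (hom_ext fun i m => by
      rw [StarAlgHom.comp_apply, inclHom_site, inclHom_site, castMat_castMat]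
      exact site_castMat (e.symm_apply_apply i) _ m)
    (hom_ext fun i m => by
      rw [StarAlgHom.comp_apply, inclHom_site, inclHom_site, castMat_castMat]
      exact site_castMat (e.apply_symm_apply i) _ m)

theorem congr_site (i : ι) (m : Mat (d i)) :
    congr e h (site i m) = site (e i) (castMat (h i) m) :=
  inclHom_site e.injective h i m

end Congr

/-! ### Splitting sites into blocks, and the CAR algebra. -/

section Sigma

/-- With finitely many sites one matrix homomorphism reaches all of them. It is injective by
simplicity, hence isometric with closed range; the range contains the dense *-algebra of the sites,
so the homomorphism is onto. -/
theorem nonempty_matrixEquiv [Fintype ι] [∀ i, NeZero (d i)] {N : ℕ} (hN : ∏ i, d i = N) :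
    Nonempty (Mat N ≃⋆ₐ[ℂ] InfTensor d) := by
  subst hN
  obtain ⟨h, hr, -⟩ := (commutingFamily_site (d := d)).exists_matrixHom Finset.univ
  have : Nonempty (Fin (∏ i, d i)) :=
    Fin.pos_iff_nonempty.1 (Finset.prod_pos fun i _ => Nat.pos_of_neZero (d i))
  have hinj : Function.Injective h := RingHom.injective (h : Mat (∏ i, d i) →+* InfTensor d)
  have hcl : IsClosed (Set.range h) :=
    (NonUnitalStarAlgHom.isometry h hinj).isClosedEmbedding.isClosed_range
  refine ⟨.ofBijective h ⟨hinj, fun x => hcl.closure_subset_iff.2 ?_ (dense_adjoin_site x)⟩⟩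
  have hle : StarAlgebra.adjoin ℂ (⋃ i, Set.range (site (d := d) i)) ≤ h.range := by
    refine StarAlgebra.adjoin_le (Set.iUnion_subset fun i => ?_)
    rintro _ ⟨m, rfl⟩
    exact hr i (Finset.mem_univ i) m
  exact hle

variable {J : ι → Type*} {b : ∀ i, J i → ℕ}

/-- The inclusion of the sites of the `i`-th block. -/
def blockHom [∀ i j, NeZero (b i j)] (i : ι) : InfTensor (b i) →⋆ₐ[ℂ] InfTensor fun x : Σ i, J i => b x.1 x.2 :=
  inclHom (sigma_mk_injective (i := i)) fun _ => rfl

theorem blockHom_site [∀ i j, NeZero (b i j)] (i : ι) (j : J i) (m : Mat (b i j)) :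
    blockHom i (site j m) = site (d := fun x : Σ i, J i => b x.1 x.2) ⟨i, j⟩ m :=
  inclHom_site _ _ j m

variable (e : ∀ i, Mat (d i) ≃⋆ₐ[ℂ] InfTensor (b i))

theorem commutingFamily_blockHom [∀ i j, NeZero (b i j)] :
    CommutingFamily fun i => (blockHom i).comp (e i : Mat (d i) →⋆ₐ[ℂ] InfTensor (b i)) := by
  intro i i' h x y
  change Commute (blockHom i (e i x)) (blockHom i' (e i' y))
  generalize e i x = a
  generalize e i' y = a'
  refine commute_hom _ (fun j m => ?_) a
  refine (commute_hom _ (fun j' m' => ?_) a').symm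
  rw [blockHom_site, blockHom_site]
  exact commutingFamily_site _ _ (fun h' => h (congrArg Sigma.fst h').symm) _ _

theorem commutingFamily_site_symm :
    CommutingFamily (d := fun x : Σ i, J i => b x.1 x.2) fun x =>
      (site (d := d) x.1).comp (((e x.1).symm : InfTensor (b x.1) →⋆ₐ[ℂ] Mat (d x.1)).comp
        (site x.2)) := by
  rintro ⟨i, j⟩ ⟨i', j'⟩ h x y
  by_cases hi : i = i'
  · subst hi
    have hj : j ≠ j' := fun h' => h (h' ▸ rfl)
    exact (commutingFamily_site j j' hj x y).map
      ((site (d := d) i).comp ((e i).symm : InfTensor (b i) →⋆ₐ[ℂ] Mat (d i)))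
  · exact commutingFamily_site i i' hi _ _

/-- The infinite tensor product of matrix algebras that are tensor products themselves. -/
def sigmaEquiv [∀ i, NeZero (d i)] [∀ i j, NeZero (b i j)] :
    InfTensor d ≃⋆ₐ[ℂ] InfTensor fun x : Σ i, J i => b x.1 x.2 :=
  .ofStarAlgHom (lift (commutingFamily_blockHom e)) (lift (commutingFamily_site_symm e))
    (hom_ext fun i m => by
      rw [StarAlgHom.comp_apply, lift_site]
      change ((lift (commutingFamily_site_symm e)).comp (blockHom i)) (e i m) = _
      have : (lift (commutingFamily_site_symm e)).comp (blockHom i) =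
          (site (d := d) i).comp ((e i).symm : InfTensor (b i) →⋆ₐ[ℂ] Mat (d i)) :=
        hom_ext fun j m => by
          rw [StarAlgHom.comp_apply, blockHom_site]
          exact lift_site (commutingFamily_site_symm e) ⟨i, j⟩ m
      rw [this]
      exact congrArg (site i) ((e i).symm_apply_apply m))
    (hom_ext fun x m => by
      rw [StarAlgHom.comp_apply, lift_site]
      refine (lift_site (commutingFamily_blockHom e) x.1 _).trans ?_
      change blockHom x.1 (e x.1 ((e x.1).symm (site x.2 m))) = _
      rw [StarAlgEquiv.apply_symm_apply, blockHom_site]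
      rfl)

/-- Each M_{2^n} is a tensor product of n copies of M_2. After splitting, the sites form a countable
set, infinite because no block is empty, and any bijection with ℕ gives the isomorphism. -/
theorem nonempty_equiv_car [∀ i, NeZero (d i)] [Countable ι] [Infinite ι] (n : ι → ℕ) (hn : ∀ i, 0 < n i)
    (hd : ∀ i, d i = 2 ^ n i) : Nonempty (InfTensor d ≃⋆ₐ[ℂ] CARAlgebra) := by
  have h : ∀ i, Nonempty (Mat (d i) ≃⋆ₐ[ℂ] InfTensor fun _ : Fin (n i) => 2) := fun i =>
    nonempty_matrixEquiv (by simp [hd])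
  have : ∀ i, Nonempty (Fin (n i)) := fun i => Fin.pos_iff_nonempty.1 (hn i)
  have : Infinite (Σ i, Fin (n i)) :=
    Infinite.of_surjective Sigma.fst fun i => ⟨⟨i, Classical.arbitrary _⟩, rfl⟩
  obtain ⟨c⟩ := nonempty_equiv_of_countable (α := Σ i, Fin (n i)) (β := ℕ)
  exact ⟨(sigmaEquiv (b := fun i (_ : Fin (n i)) => 2) fun i => (h i).some).trans
    (congr c fun _ => rfl)⟩

end Sigma

/-- A countable set has countably many finite subsets, and the matrix algebra of each is separable;
their union is dense. -/
theorem separableSpace [Countable ι] : TopologicalSpace.SeparableSpace (InfTensor d) := by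
  have hF : ∀ F : Finset ι, ∃ h : Mat (∏ i ∈ F, d i) →⋆ₐ[ℂ] InfTensor d,
      ∀ i ∈ F, ∀ x, site i x ∈ h.range := fun F =>
    let ⟨h, hr, _⟩ := (commutingFamily_site (d := d)).exists_matrixHom F
    ⟨h, hr⟩
  choose h hr using hF
  have hsep : TopologicalSpace.IsSeparable (⋃ F, Set.range (h F)) :=
    .iUnion fun F => TopologicalSpace.isSeparable_range (h F).continuous_of_cstarAlgebra
  refine TopologicalSpace.isSeparable_univ_iff.1 (hsep.closure.mono fun x _ => ?_)
  refine closure_mono (fun y hy => ?_) (dense_adjoin_site x)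
  obtain ⟨F, hF⟩ := exists_finset_of_mem_adjoin hy
  exact Set.mem_iUnion.2 ⟨F, hF _ (hr F)⟩

end InfTensor

/-! ### States -/

namespace IsState

variable {A B : Type*} [CStarAlgebra A] [CStarAlgebra B]

theorem comp {s : B →ₗ[ℂ] ℂ} (hs : IsState s) (f : A →⋆ₐ[ℂ] B) :
    IsState (s ∘ₗ f.toAlgHom.toLinearMap) where
  nonneg a := by
    change 0 ≤ s (f (star a * a))
    rw [map_mul, map_star]
    exact hs.nonneg _
  map_one := by
    change s (f 1) = 1
    rw [_root_.map_one, hs.map_one]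

/-- In the spectral order the positive elements are those of the form `star b * b`, so `s` is a
positive linear map, and these are automatically bounded. -/
theorem continuous {s : A →ₗ[ℂ] ℂ} (hs : IsState s) : Continuous s := by
  let _ := CStarAlgebra.spectralOrder A
  have := CStarAlgebra.spectralOrderedRing A
  obtain ⟨C, hC⟩ := PositiveLinearMap.exists_norm_apply_le (PositiveLinearMap.mk₀ s fun x hx => by
    obtain ⟨b, rfl⟩ := CStarAlgebra.nonneg_iff_eq_star_mul_self.1 hx
    exact hs.nonneg b)
  exact AddMonoidHomClass.continuous_of_bound s C hC

end IsState

theorem List.prod_map_mul_prod_map {ι M : Type*} [Monoid M] {u v : ι → M} {L : List ι}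
    (hL : L.Nodup) (h : ∀ i j, i ≠ j → Commute (u i) (v j)) :
    (L.map u).prod * (L.map v).prod = (L.map fun i => u i * v i).prod := by
  induction L with
  | nil => simp
  | cons i L ih =>
    rw [List.nodup_cons] at hL
    have hc : Commute (L.map u).prod (v i) := by
      refine (Commute.list_prod_right _ _ fun y hy => ?_).symm
      obtain ⟨j, hj, rfl⟩ := List.mem_map.1 hy
      exact (h j i fun e => hL.1 (e ▸ hj)).symm
    simp only [List.map_cons, List.prod_cons]
    rw [← ih hL.2, mul_assoc, ← mul_assoc _ (v i), hc.eq]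
    simp only [mul_assoc]

theorem List.star_prod_map {ι M : Type*} [Monoid M] [StarMul M] {u : ι → M} {L : List ι}
    (hL : L.Nodup) (h : ∀ i j, i ≠ j → Commute (u i) (u j)) :
    star (L.map u).prod = (L.map fun i => star (u i)).prod := by
  induction L with
  | nil => simp
  | cons i L ih =>
    rw [List.nodup_cons] at hL
    have hc : Commute (u i) (L.map u).prod := by
      refine Commute.list_prod_right _ _ fun y hy => ?_
      obtain ⟨j, hj, rfl⟩ := List.mem_map.1 hy
      exact h i j fun e => hL.1 (e ▸ hj)
    simp only [List.map_cons, List.prod_cons]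
    rw [hc.eq, star_mul, ih hL.2]

namespace InfTensor

variable {ι κ : Type*} {d : ι → ℕ} {d' : κ → ℕ}

/-! ### Density of the product elements -/

/-- The product of the matrices `a i` at the sites `i` of a list. -/
def listProd (L : List ι) (a : ∀ i, Mat (d i)) : InfTensor d :=
  (L.map fun i => site i (a i)).prod

theorem listProd_mul {L : List ι} (hL : L.Nodup) (a b : ∀ i, Mat (d i)) :
    listProd L a * listProd L b = listProd L (a * b) := by
  rw [listProd, listProd, List.prod_map_mul_prod_map hL
    fun i j h => commutingFamily_site i j h (a i) (b j)]
  simp [listProd]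

theorem star_listProd {L : List ι} (hL : L.Nodup) (a : ∀ i, Mat (d i)) :
    star (listProd L a) = listProd L (star a) := by
  rw [listProd, List.star_prod_map hL fun i j h => commutingFamily_site i j h (a i) (a j)]
  exact congrArg List.prod (List.map_congr_left fun i _ => (map_star (site i) (a i)).symm)

theorem listProd_one (L : List ι) : listProd (d := d) L 1 = 1 := by
  simp [listProd]

-- Padding with identities makes a single-site matrix a product element of every list that contains
-- its site. Hence `listSpan` contains these site algebras.
open scoped Classical in
theorem listProd_update {L : List ι} (hL : L.Nodup) {i : ι} (hi : i ∈ L) (m : Mat (d i)) :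
    listProd L (Function.update (1 : ∀ i, Mat (d i)) i m) = site i m := by
  induction L with
  | nil => simp at hi
  | cons j L ih =>
    rw [List.nodup_cons] at hL
    rw [listProd, List.map_cons, List.prod_cons]
    change _ * listProd L _ = _
    rcases List.mem_cons.1 hi with rfl | hi
    · have : listProd L (Function.update (1 : ∀ i, Mat (d i)) i m) = listProd L 1 := by
        rw [listProd, listProd]
        refine congrArg List.prod (List.map_congr_left fun k hk => ?_)
        have hki : k ≠ i := fun e => hL.1 (e ▸ hk)
        rw [Function.update_of_ne hki]
      rw [this, listProd_one, Function.update_self, mul_one]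
    · have hji : j ≠ i := fun e => hL.1 (e ▸ hi)
      rw [ih hL.2 hi, Function.update_of_ne hji]
      simp

/-- The span of the product elements of a list of sites. -/
def listSpan (L : List ι) (hL : L.Nodup) : StarSubalgebra ℂ (InfTensor d) where
  carrier := Submodule.span ℂ (Set.range (listProd (d := d) L))
  mul_mem' {x y} hx hy := by
    have h := Submodule.mul_mem_mul hx hy
    rw [Submodule.span_mul_span] at h
    refine Submodule.span_mono ?_ h
    rintro _ ⟨_, ⟨a, rfl⟩, _, ⟨b, rfl⟩, rfl⟩
    exact ⟨a * b, (listProd_mul hL a b).symm⟩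
  add_mem' hx hy := add_mem hx hy
  algebraMap_mem' c := by
    rw [Algebra.algebraMap_eq_smul_one, ← listProd_one L]
    exact Submodule.smul_mem _ c (Submodule.subset_span ⟨1, rfl⟩)
  star_mem' {x} hx := by
    refine Submodule.span_induction (p := fun x _ => star x ∈
      Submodule.span ℂ (Set.range (listProd (d := d) L))) ?_ ?_ ?_ ?_ hx
    · rintro _ ⟨a, rfl⟩
      exact Submodule.subset_span ⟨star a, (star_listProd hL a).symm⟩
    · simp
    · intro x y _ _ hx hy
      rw [star_add]
      exact add_mem hx hy
    · intro c x _ hx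
      rw [star_smul]
      exact Submodule.smul_mem _ _ hx

/-- Properties of all the pairs of elements of an infinite tensor product that are linear in both
of them. -/
theorem induction₂ {P : InfTensor d → InfTensor d → Prop}
    (closed_left : ∀ y, IsClosed {x | P x y}) (closed_right : ∀ x, IsClosed {y | P x y})
    (add_left : ∀ x x' y, P x y → P x' y → P (x + x') y)
    (add_right : ∀ x y y', P x y → P x y' → P x (y + y'))
    (smul_left : ∀ (c : ℂ) x y, P x y → P (c • x) y)
    (smul_right : ∀ (c : ℂ) x y, P x y → P x (c • y))
    (prod : ∀ L : List ι, L.Nodup → ∀ a b, P (listProd L a) (listProd L b))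
    (x y : InfTensor d) : P x y := by
  classical
  refine (closed_left y).closure_subset_iff.2 (fun x hx => ?_) (dense_adjoin_site x)
  refine (closed_right x).closure_subset_iff.2 (fun y hy => ?_) (dense_adjoin_site y)
  obtain ⟨F, hF⟩ := exists_finset_of_mem_adjoin hx
  obtain ⟨G, hG⟩ := exists_finset_of_mem_adjoin hy
  -- Both elements are expanded over one common list of sites, since `prod` speaks of two products
  -- over the same list.
  have hL := (F ∪ G).nodup_toList
  have hmem : ∀ i ∈ F ∪ G, ∀ m, site i m ∈ listSpan (d := d) _ hL := fun i hi m =>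
    Submodule.subset_span ⟨_, listProd_update hL (Finset.mem_toList.2 hi) m⟩
  have hx' : x ∈ Submodule.span ℂ (Set.range (listProd (d := d) (F ∪ G).toList)) :=
    hF _ fun i hi => hmem i (Finset.mem_union_left G hi)
  have hy' : y ∈ Submodule.span ℂ (Set.range (listProd (d := d) (F ∪ G).toList)) :=
    hG _ fun i hi => hmem i (Finset.mem_union_right F hi)
  have h1 : ∀ a, P (listProd (F ∪ G).toList a) y := fun a => by
    refine Submodule.span_induction (p := fun y _ => P (listProd (F ∪ G).toList a) y) ?_ ?_ ?_ ?_
      hy'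
    · rintro _ ⟨b, rfl⟩
      exact prod _ hL a b
    -- The zero vector is the multiple by 0 of any product element, so it needs no hypothesis of its
    -- own.
    · simpa using smul_right 0 _ _ (prod _ hL a a)
    · exact fun y y' _ _ => add_right _ y y'
    · exact fun c y _ => smul_right c _ y
  refine Submodule.span_induction (p := fun x _ => P x y) ?_ ?_ ?_ ?_ hx'
  · rintro _ ⟨a, rfl⟩
    exact h1 a
  · simpa using smul_left 0 _ _ (h1 0)
  · exact fun x x' _ _ => add_left x x' y
  · exact fun c x _ => smul_left c x y

/-- Two functionals of a tensor product that are equal on the product elements. -/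
theorem functional_ext {s s' : MaxTensor (InfTensor d) (InfTensor d) →ₗ[ℂ] ℂ}
    (hs : Continuous s) (hs' : Continuous s')
    (h : ∀ L : List ι, L.Nodup → ∀ a b, s (.tmul (listProd L a) (listProd L b)) =
      s' (.tmul (listProd L a) (listProd L b))) : s = s' := by
  have key : ∀ a b, s (.tmul a b) = s' (.tmul a b) := by
    refine induction₂ (P := fun a b => s (.tmul a b) = s' (.tmul a b)) (fun y => ?_) (fun x => ?_)
      ?_ ?_ ?_ ?_ h
    · exact isClosed_eq (hs.comp (MaxTensor.continuous_tmul_left y))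
        (hs'.comp (MaxTensor.continuous_tmul_left y))
    · exact isClosed_eq (hs.comp (MaxTensor.continuous_tmul_right x))
        (hs'.comp (MaxTensor.continuous_tmul_right x))
    · intro x x' y h1 h2
      rw [MaxTensor.add_tmul, map_add, map_add, h1, h2]
    · intro x x' y h1 h2
      rw [MaxTensor.tmul_add, map_add, map_add, h1, h2]
    · intro c x y h1
      rw [MaxTensor.smul_tmul, map_smul, map_smul, h1]
    · intro c x y h1
      rw [MaxTensor.tmul_smul, map_smul, map_smul, h1]
  refine LinearMap.ext fun X => MaxTensor.induction (P := fun X => s X = s' X)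
    (isClosed_eq hs hs') key (fun x y hx hy => ?_) X
  rw [map_add, map_add, hx, hy]

/-! ### Product states -/

/-- `s` is the tensor product of functionals `ω i` of the pairs of sites with index `i`. -/
structure IsProductState (s : MaxTensor (InfTensor d) (InfTensor d) →ₗ[ℂ] ℂ)
    (ω : ∀ i, Mat (d i) → Mat (d i) → ℂ) : Prop where
  isState : IsState s
  apply_prod : ∀ L : List ι, L.Nodup → ∀ a b,
    s (.tmul (listProd L a) (listProd L b)) = (L.map fun i => ω i (a i) (b i)).prod

theorem IsProductState.unique {s s' : MaxTensor (InfTensor d) (InfTensor d) →ₗ[ℂ] ℂ}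
    {ω : ∀ i, Mat (d i) → Mat (d i) → ℂ} (hs : IsProductState s ω) (hs' : IsProductState s' ω) :
    s = s' :=
  functional_ext hs.isState.continuous hs'.isState.continuous fun L hL a b => by
    rw [hs.apply_prod L hL, hs'.apply_prod L hL]

section Ground

variable [∀ i, NeZero (d i)]

open scoped Classical in
variable (d) in
/-- The basis vector of the configuration with all the labels zero. -/
def vacuum : Hilb d := lp.single 2 (fun _ => 0) (1 : ℂ)

theorem siteRep_single_vacuum (i : ι) : siteRep i (Matrix.single 0 0 1) (vacuum d) = vacuum d := by
  classical
  have h : siteRep (d := d) i (Matrix.single 0 0 1) = matrixUnit i 0 0 := by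
    change ∑ k, ∑ l, (Matrix.single 0 0 (1 : ℂ) : Mat (d i)) k l • matrixUnit i k l = _
    rw [Finset.sum_eq_single 0, Finset.sum_eq_single 0]
    · simp
    · intro l _ hl
      simp [hl.symm]
    · simp
    · intro k _ hk
      simp [hk.symm]
    · simp
  rw [h]
  refine lp.ext (funext fun x => ?_)
  rw [matrixUnit_apply]
  have hflip : flip i 0 0 x = x := by simp [flip]
  rw [hflip]
  split_ifs with hx
  · rfl
  · rw [vacuum, lp.single_apply_ne]
    rintro rfl
    exact hx rfl

variable (d) in
/-- The vector state of the configuration with all the labels zero. -/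
def groundState : InfTensor d →ₗ[ℂ] ℂ where
  toFun x := inner ℂ (vacuum d) (x.1 (vacuum d))
  map_add' x y := by
    change inner ℂ _ ((x.1 + y.1) _) = _
    rw [add_apply, inner_add_right]
  map_smul' c x := by
    change inner ℂ _ ((c • x.1) _) = _
    rw [smul_apply, inner_smul_right]
    rfl

theorem groundState_apply (x : InfTensor d) :
    groundState d x = inner ℂ (vacuum d) (x.1 (vacuum d)) := rfl

theorem isState_groundState : IsState (groundState d) where
  nonneg a := by
    rw [groundState_apply]
    change 0 ≤ inner ℂ (vacuum d) ((star a.1 * a.1) (vacuum d))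
    rw [mul_apply_eq_comp, ContinuousLinearMap.star_eq_adjoint,
      ContinuousLinearMap.adjoint_inner_right, inner_self_eq_norm_sq_to_K]
    exact pow_nonneg (Complex.zero_le_real.2 (norm_nonneg (a.1 (vacuum d)))) 2
  map_one := by
    classical
    rw [groundState_apply]
    change inner ℂ (vacuum d) (vacuum d) = 1
    rw [inner_self_eq_norm_sq_to_K, vacuum, lp.norm_single (by norm_num)]
    simp

/-- The projection |0⟩⟨0| at a site is self-adjoint and fixes the vacuum, so it can be absorbed into
the left vector of the inner product. -/
theorem groundState_single_mul (i : ι) (x : InfTensor d) :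
    groundState d (site i (Matrix.single 0 0 1) * x) = groundState d x := by
  have hstar : star (siteRep (d := d) i (Matrix.single 0 0 1)) =
      siteRep i (Matrix.single 0 0 1) := by
    rw [← map_star, Matrix.star_eq_conjTranspose, Matrix.conjTranspose_single, star_one]
  rw [groundState_apply, groundState_apply]
  change inner ℂ (vacuum d) (siteRep i (Matrix.single 0 0 1) (x.1 (vacuum d))) = _
  rw [← hstar, ContinuousLinearMap.star_eq_adjoint, ContinuousLinearMap.adjoint_inner_right,
    siteRep_single_vacuum]

theorem groundState_mul_single (i : ι) (x : InfTensor d) :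
    groundState d (x * site i (Matrix.single 0 0 1)) = groundState d x := by
  rw [groundState_apply, groundState_apply]
  change inner ℂ (vacuum d) (x.1 (siteRep i (Matrix.single 0 0 1) (vacuum d))) = _
  rw [siteRep_single_vacuum]

/-- With e = |0⟩⟨0| at the first site, e can be inserted on both sides for free. It commutes with
the remaining factors, and e a e = a₀₀ e extracts the scalar. -/
theorem groundState_listProd {L : List ι} (hL : L.Nodup) (a : ∀ i, Mat (d i)) :
    groundState d (listProd L a) = (L.map fun i => a i 0 0).prod := by
  induction L with
  | nil => exact isState_groundState.map_one
  | cons i L ih =>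
    rw [List.nodup_cons] at hL
    have hc : Commute (listProd L a) (site i (Matrix.single 0 0 1)) := by
      refine (Commute.list_prod_right _ _ fun y hy => ?_).symm
      obtain ⟨j, hj, rfl⟩ := List.mem_map.1 hy
      exact commutingFamily_site i j (fun e => hL.1 (e ▸ hj)) _ _
    have hm : (Matrix.single 0 0 1 : Mat (d i)) * a i * Matrix.single 0 0 1 =
        a i 0 0 • Matrix.single 0 0 1 := by
      rw [Matrix.single_mul_mul_single]
      simp
    change groundState d (site i (a i) * listProd L a) = _
    rw [← groundState_single_mul i, ← groundState_mul_single i, mul_assoc, mul_assoc, hc.eq,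
      ← mul_assoc (site i (a i)), ← mul_assoc, ← map_mul, ← map_mul, ← mul_assoc, hm, map_smul,
      smul_mul_assoc, map_smul, groundState_single_mul, ih hL.2]
    simp

end Ground

end InfTensor

/-! ### Vector states as diagonal matrix entries. -/

/-- A unit vector extends to an orthonormal basis with the prescribed index `k`; the basis vectors
are the columns of `W`. -/
theorem exists_unitary_col {n : Type*} [Fintype n] [DecidableEq n] (k : n)
    {φ : EuclideanSpace ℂ n} (hφ : ‖φ‖ = 1) :
    ∃ W : Matrix.unitaryGroup n ℂ, ∀ i, (W : Matrix n n ℂ) i k = φ i := by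
  have ho : Orthonormal ℂ (Set.domRestrict {k} fun _ => φ) :=
    ⟨fun _ => hφ, fun i j h => (h (Subsingleton.elim i j)).elim⟩
  obtain ⟨b, hb⟩ := ho.exists_orthonormalBasis_extension_of_card_eq (by simp)
  refine ⟨⟨(EuclideanSpace.basisFun n ℂ).toBasis.toMatrix b,
    OrthonormalBasis.toMatrix_orthonormalBasis_mem_unitary _ _⟩, fun i => ?_⟩
  simp [Module.Basis.toMatrix_apply, hb k rfl]

theorem expect_eq_sum {N : ℕ} (φ : BiVec N) (m m' : Mat N) :
    expect φ m m' = ∑ k, star (φ k) * ∑ l, (m ⊗ₖ m') k l * φ l := by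
  rw [expect, PiLp.inner_apply]
  refine Finset.sum_congr rfl fun k _ => ?_
  rw [RCLike.inner_apply, mul_comm]
  rfl

/-- The column condition says W e_k = φ, so ⟨e_k|W⋆ M W|e_k⟩ = ⟨φ|M|φ⟩. -/
theorem expect_eq_conj_apply {N : ℕ} {φ : BiVec N} {k : Fin N × Fin N}
    {W : Matrix (Fin N × Fin N) (Fin N × Fin N) ℂ} (hW : ∀ i, W i k = φ i) (m m' : Mat N) :
    (star W * (m ⊗ₖ m') * W) k k = expect φ m m' := by
  rw [mul_assoc, Matrix.mul_apply, expect_eq_sum]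
  refine Finset.sum_congr rfl fun i _ => ?_
  rw [Matrix.mul_apply, Matrix.star_apply, hW]
  simp only [hW]

section Pair

variable {N : ℕ}

/-- The *-isomorphism `x ↦ W⋆ x W` of the Kronecker product. -/
def pairEquiv (W : Matrix.unitaryGroup (Fin N × Fin N) ℂ) :
    Mat N ⊗[ℂ] Mat N ≃⋆ₐ[ℂ] Mat (N * N) :=
  ((Matrix.kroneckerStarAlgEquiv (Fin N) (Fin N) ℂ).trans
    (Unitary.conjStarAlgAut ℂ _ W).symm).trans (Matrix.reindexStarAlgEquiv finProdFinEquiv)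

/-- The *-homomorphism `m ↦ W⋆ (m ⊗ 1) W`. -/
def pairLeft (W : Matrix.unitaryGroup (Fin N × Fin N) ℂ) : Mat N →⋆ₐ[ℂ] Mat (N * N) :=
  (pairEquiv W : Mat N ⊗[ℂ] Mat N →⋆ₐ[ℂ] Mat (N * N)).comp MaxTensor.algInl

/-- The *-homomorphism `m ↦ W⋆ (1 ⊗ m) W`. -/
def pairRight (W : Matrix.unitaryGroup (Fin N × Fin N) ℂ) : Mat N →⋆ₐ[ℂ] Mat (N * N) :=
  (pairEquiv W : Mat N ⊗[ℂ] Mat N →⋆ₐ[ℂ] Mat (N * N)).comp MaxTensor.algInr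

theorem commute_pairLeft_pairRight (W : Matrix.unitaryGroup (Fin N × Fin N) ℂ) (m m' : Mat N) :
    Commute (pairLeft W m) (pairRight W m') := by
  have h : Commute (m ⊗ₜ[ℂ] (1 : Mat N)) ((1 : Mat N) ⊗ₜ[ℂ] m') := by simp [Commute, SemiconjBy]
  exact h.map (pairEquiv W)

theorem pairLeft_mul_pairRight (W : Matrix.unitaryGroup (Fin N × Fin N) ℂ) (m m' : Mat N) :
    pairLeft W m * pairRight W m' = Matrix.reindexStarAlgEquiv finProdFinEquiv
      (star (W : Matrix (Fin N × Fin N) (Fin N × Fin N) ℂ) * (m ⊗ₖ m') *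
        (W : Matrix (Fin N × Fin N) (Fin N × Fin N) ℂ)) := by
  have h : (m ⊗ₜ[ℂ] (1 : Mat N)) * ((1 : Mat N) ⊗ₜ[ℂ] m') = m ⊗ₜ[ℂ] m' := by simp
  change pairEquiv W (m ⊗ₜ[ℂ] (1 : Mat N)) * pairEquiv W ((1 : Mat N) ⊗ₜ[ℂ] m') = _
  rw [← map_mul, h]
  simp [pairEquiv]

theorem pairLeft_mul_pairRight_apply [NeZero N] {W : Matrix.unitaryGroup (Fin N × Fin N) ℂ}
    {φ : BiVec N} (hW : ∀ i, W.1 i (finProdFinEquiv.symm 0) = φ i)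
    (m m' : Mat N) : (pairLeft W m * pairRight W m') 0 0 = expect φ m m' := by
  rw [pairLeft_mul_pairRight]
  exact expect_eq_conj_apply hW m m'

end Pair

/-! ### Existence of product states, and their transport along the site isomorphisms. -/

namespace InfTensor

variable {ι κ : Type*} {d : ι → ℕ} {d' : κ → ℕ} [∀ i, NeZero (d i)]

/-- The two copies are mapped into one infinite tensor product with sites of dimension `d i * d i`,
by m ↦ W_i⋆ (m ⊗ 1) W_i and m ↦ W_i⋆ (1 ⊗ m) W_i. These ranges commute, so the maximal tensor
product maps there too, and the ground state pulls back to the product state. Positivity comes from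
the pullback and needs no separate argument. -/
theorem exists_isProductState (φ : ∀ i, BiVec (d i)) (hφ : ∀ i, ‖φ i‖ = 1) :
    ∃ s : MaxTensor (InfTensor d) (InfTensor d) →ₗ[ℂ] ℂ,
      IsProductState s fun i => expect (φ i) := by
  choose W hW using fun i => exists_unitary_col (finProdFinEquiv.symm 0) (hφ i)
  let D : ι → ℕ := fun i => d i * d i
  have hl : CommutingFamily fun i => (site (d := D) i).comp (pairLeft (W i)) :=
    fun i j h _ _ => commutingFamily_site i j h _ _
  have hr : CommutingFamily fun i => (site (d := D) i).comp (pairRight (W i)) :=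
    fun i j h _ _ => commutingFamily_site i j h _ _
  have hlr : ∀ a b, Commute (lift hl a) (lift hr b) := by
    intro a b
    refine commute_hom _ (fun i m => ?_) a
    refine (commute_hom _ (fun j m' => ?_) b).symm
    rw [lift_site, lift_site]
    by_cases h : i = j
    · subst h
      exact ((commute_pairLeft_pairRight (W i) m m').map (site (d := D) i)).symm
    · exact (commutingFamily_site i j h _ _).symm
  refine ⟨_, isState_groundState.comp (MaxTensor.lift (lift hl) (lift hr) hlr), ?_⟩
  intro L hL a b
  change groundState D (MaxTensor.lift (lift hl) (lift hr) hlr (.tmul _ _)) = _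
  rw [MaxTensor.lift_tmul]
  have h1 : lift hl (listProd L a) = listProd L fun i => pairLeft (W i) (a i) := by
    rw [listProd, map_list_prod, List.map_map]
    exact congrArg List.prod (List.map_congr_left fun i _ => lift_site hl i (a i))
  have h2 : lift hr (listProd L b) = listProd L fun i => pairRight (W i) (b i) := by
    rw [listProd, map_list_prod, List.map_map]
    exact congrArg List.prod (List.map_congr_left fun i _ => lift_site hr i (b i))
  rw [h1, h2, listProd_mul hL, groundState_listProd hL]
  exact congrArg List.prod (List.map_congr_left fun i _ =>
    pairLeft_mul_pairRight_apply (hW i) (a i) (b i))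


theorem congr_listProd [∀ i, NeZero (d' i)] (e : ι ≃ κ) (h : ∀ i, d i = d' (e i)) (L : List ι)
    (a : ∀ i, Mat (d i)) : congr e h (listProd L a) =
      listProd (L.map e) (Equiv.piCongrLeft (fun k => Mat (d' k)) e fun i =>
        castMat (h i) (a i)) := by
  rw [listProd, listProd, map_list_prod, List.map_map, List.map_map]
  refine congrArg List.prod (List.map_congr_left fun i _ => ?_)
  rw [Function.comp_apply, Function.comp_apply, congr_site, Equiv.piCongrLeft_apply_apply]

/-- A bijection relabels the factors of a product element and keeps its list free of duplicates; the
functional at `i` becomes the one at `e i`. -/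
theorem IsProductState.comp_congr [∀ i, NeZero (d' i)] (e : ι ≃ κ) (h : ∀ i, d i = d' (e i))
    {s : MaxTensor (InfTensor d') (InfTensor d') →ₗ[ℂ] ℂ} {ω : ∀ k, Mat (d' k) → Mat (d' k) → ℂ}
    (hs : IsProductState s ω) :
    IsProductState (s ∘ₗ (MaxTensor.map (congr e h : InfTensor d →⋆ₐ[ℂ] InfTensor d')
        (congr e h : InfTensor d →⋆ₐ[ℂ] InfTensor d')).toAlgHom.toLinearMap)
      fun i m m' => ω (e i) (castMat (h i) m) (castMat (h i) m') := by
  refine ⟨hs.isState.comp _, fun L hL a b => ?_⟩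
  change s (MaxTensor.map (congr e h : InfTensor d →⋆ₐ[ℂ] InfTensor d')
        (congr e h : InfTensor d →⋆ₐ[ℂ] InfTensor d') (.tmul _ _)) = _
  rw [MaxTensor.map_tmul]
  change s (.tmul (congr e h _) (congr e h _)) = _
  rw [congr_listProd, congr_listProd, hs.apply_prod _ (hL.map e.injective), List.map_map]
  refine congrArg List.prod (List.map_congr_left fun i _ => ?_)
  rw [Function.comp_apply, Equiv.piCongrLeft_apply_apply, Equiv.piCongrLeft_apply_apply]

/-- The family of the matrices `a i`, extended to the additional site. -/
def optionFamily {N : ℕ} (m : Mat N) (a : ∀ i, Mat (d i)) : ∀ o, Mat (optionDim d N o)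
  | none => m
  | some i => a i

theorem optionEquiv_tmul_listProd {N : ℕ} [NeZero N] (L : List ι) (a : ∀ i, Mat (d i))
    (m : Mat N) : optionEquiv d N (.tmul (listProd L a) m) =
      listProd (L.map some ++ [none]) (optionFamily m a) := by
  rw [← MaxTensor.inl_mul_inr, map_mul, optionEquiv_inr, listProd, listProd, List.map_append,
    List.prod_append, List.map_map, map_list_prod, map_list_prod, List.map_map, List.map_map]
  refine congrArg₂ _ (congrArg List.prod (List.map_congr_left fun i _ =>
    optionEquiv_inl_site d N i (a i))) ?_
  simp [optionFamily]

/-- Both sides are linear and continuous in `a` and in `b` separately, so product elements suffice,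
and there the additional site contributes the last factor. Only the site functionals of `S` matter,
so the result applies to a product state both before and after a permutation of the sites. -/
theorem IsProductState.isTensorVectorState {N : ℕ} [NeZero N] {φ : BiVec N}
    {s : MaxTensor (InfTensor d) (InfTensor d) →ₗ[ℂ] ℂ} {ω : ∀ i, Mat (d i) → Mat (d i) → ℂ}
    (hs : IsProductState s ω)
    {S : MaxTensor (InfTensor (optionDim d N)) (InfTensor (optionDim d N)) →ₗ[ℂ] ℂ}
    {Ω : ∀ o, Mat (optionDim d N o) → Mat (optionDim d N o) → ℂ} (hS : IsProductState S Ω)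
    (hnone : Ω none = expect φ) (hsome : ∀ i, Ω (some i) = ω i) :
    IsTensorVectorState s φ (S ∘ₗ (MaxTensor.map
      (optionEquiv d N : MaxTensor (InfTensor d) (Mat N) →⋆ₐ[ℂ] InfTensor (optionDim d N))
      (optionEquiv d N : MaxTensor (InfTensor d) (Mat N) →⋆ₐ[ℂ] InfTensor (optionDim d N))
        ).toAlgHom.toLinearMap) := by
  refine ⟨hS.isState.comp _, fun a m b m' => ?_⟩
  change S (MaxTensor.map
      (optionEquiv d N : MaxTensor (InfTensor d) (Mat N) →⋆ₐ[ℂ] InfTensor (optionDim d N))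
      (optionEquiv d N : MaxTensor (InfTensor d) (Mat N) →⋆ₐ[ℂ] InfTensor (optionDim d N))
      (.tmul _ _)) = _
  rw [MaxTensor.map_tmul]
  change S (.tmul (optionEquiv d N (.tmul a m)) (optionEquiv d N (.tmul b m'))) = _
  have hSc := hS.isState.continuous
  have hsc := hs.isState.continuous
  have hθ : Continuous (optionEquiv d N) := (optionHom d N).continuous_of_cstarAlgebra
  refine induction₂ (P := fun a b => S (.tmul (optionEquiv d N (.tmul a m))
    (optionEquiv d N (.tmul b m'))) = s (.tmul a b) * expect φ m m')
    (fun y => ?_) (fun x => ?_) ?_ ?_ ?_ ?_ (fun L hL a b => ?_) a b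
  · exact isClosed_eq (hSc.comp ((MaxTensor.continuous_tmul_left _).comp
      (hθ.comp (MaxTensor.continuous_tmul_left m))))
      ((hsc.comp (MaxTensor.continuous_tmul_left y)).mul continuous_const)
  · exact isClosed_eq (hSc.comp ((MaxTensor.continuous_tmul_right _).comp
      (hθ.comp (MaxTensor.continuous_tmul_left m'))))
      ((hsc.comp (MaxTensor.continuous_tmul_right x)).mul continuous_const)
  · intro x x' y h1 h2
    rw [MaxTensor.add_tmul, map_add, MaxTensor.add_tmul, map_add, h1, h2, MaxTensor.add_tmul,
      map_add, add_mul]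
  · intro x y y' h1 h2
    rw [MaxTensor.add_tmul, map_add, MaxTensor.tmul_add, map_add, h1, h2, MaxTensor.tmul_add,
      map_add, add_mul]
  · intro c x y h
    rw [MaxTensor.smul_tmul, map_smul, MaxTensor.smul_tmul, map_smul, h, MaxTensor.smul_tmul,
      map_smul, smul_mul_assoc]
  · intro c x y h
    rw [MaxTensor.smul_tmul, map_smul, MaxTensor.tmul_smul, map_smul, h, MaxTensor.tmul_smul,
      map_smul, smul_mul_assoc]
  · have hnd : (L.map some ++ [none]).Nodup := by
      rw [List.nodup_append]
      exact ⟨hL.map (Option.some_injective ι), List.nodup_singleton _, by simp⟩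
    rw [optionEquiv_tmul_listProd, optionEquiv_tmul_listProd, hS.apply_prod _ hnd,
      hs.apply_prod L hL, List.map_append, List.prod_append, List.map_map]
    congr 1
    · refine congrArg List.prod (List.map_congr_left fun i _ => ?_)
      rw [Function.comp_apply, hsome]
      rfl
    · simp [hnone, optionFamily]

end InfTensor

/-! ### Schmidt vectors -/

/-- The coordinates are positive, hence determined by their rational squares. -/
theorem countable_schmidtSet (n : ℕ+) : (schmidtSet n).Countable := by
  refine (Set.countable_range fun r : Fin (2 ^ (n : ℕ)) → ℚ =>
    (WithLp.toLp 2 fun i => √(r i : ℝ) : EuclideanSpace ℝ (Fin (2 ^ (n : ℕ))))).mono ?_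
  rintro q ⟨hq, -⟩
  choose h0 r hr using hq
  refine ⟨r, ?_⟩
  ext i
  change √(r i : ℝ) = q i
  rw [← hr, Real.sqrt_sq (h0 i).le]

theorem mem_closure_pos_rat {p : ℝ} (hp : 0 ≤ p) :
    p ∈ closure {t : ℝ | 0 < t ∧ ∃ r : ℚ, t = r} := by
  refine Metric.mem_closure_iff.2 fun ε hε => ?_
  obtain ⟨r, h1, h2⟩ := exists_rat_btwn (show p < p + ε by linarith)
  refine ⟨r, ⟨hp.trans_lt h1, r, rfl⟩, ?_⟩
  rw [Real.dist_eq, abs_lt]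
  constructor <;> linarith

/-- The weights q_i² are approximated by positive rationals t_i, and √(t_i / ∑ t_j) is normalized
again with rational squares. The normalization is continuous at the weights of `q`, whose sum is 1,
and returns `q` there because q_i ≥ 0. -/
theorem subset_closure_schmidtSet (n : ℕ+) :
    {q : EuclideanSpace ℝ (Fin (2 ^ (n : ℕ))) | (∀ i, 0 ≤ q i) ∧ ∑ i, q i ^ 2 = 1} ⊆
      closure (schmidtSet n) := by
  rintro q ⟨hq, hsum⟩
  let T : Set (Fin (2 ^ (n : ℕ)) → ℝ) := Set.univ.pi fun _ => {t : ℝ | 0 < t ∧ ∃ r : ℚ, t = r}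
  let Ψ : (Fin (2 ^ (n : ℕ)) → ℝ) → EuclideanSpace ℝ (Fin (2 ^ (n : ℕ))) := fun t =>
    WithLp.toLp 2 fun i => √(t i / ∑ j, t j)
  let p : Fin (2 ^ (n : ℕ)) → ℝ := fun i => q i ^ 2
  have hpT : p ∈ closure T := by
    rw [closure_pi_set]
    exact fun i _ => mem_closure_pos_rat (sq_nonneg _)
  have hcont : ContinuousAt Ψ p := by
    refine (PiLp.continuous_toLp 2 _).continuousAt.comp (continuousAt_pi.2 fun i => ?_)
    refine Real.continuous_sqrt.continuousAt.comp (ContinuousAt.div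
      (continuous_apply i).continuousAt
      (continuous_finsetSum _ fun j _ => continuous_apply j).continuousAt ?_)
    change ∑ i, q i ^ 2 ≠ 0
    rw [hsum]
    exact one_ne_zero
  have hΨp : Ψ p = q := by
    ext i
    change √(q i ^ 2 / ∑ j, q j ^ 2) = q i
    rw [hsum, div_one, Real.sqrt_sq (hq i)]
  rw [← hΨp]
  refine closure_mono ?_ (mem_closure_image hcont hpT)
  rintro _ ⟨t, ht, rfl⟩
  have h0 : ∀ i, 0 < t i := fun i => (ht i trivial).1
  have hs : 0 < ∑ j, t j := Finset.sum_pos (fun i _ => h0 i) Finset.univ_nonempty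
  have hsq : ∀ i, Ψ t i ^ 2 = t i / ∑ j, t j := fun i => Real.sq_sqrt (div_pos (h0 i) hs).le
  choose r hr using fun i => (ht i trivial).2
  refine ⟨fun i => ⟨Real.sqrt_pos.2 (div_pos (h0 i) hs), r i / ∑ j, r j, ?_⟩, ?_⟩
  · rw [hsq]
    push_cast
    simp only [hr]
  · simp only [hsq]
    rw [← Finset.sum_div, div_self hs.ne']

/-! ### The Schmidt decomposition -/

/-- If W diagonalizes M⋆M, then the columns of A = MW are orthogonal, with the eigenvalues as
squared norms. The nonzero columns are normalized and completed to an orthonormal basis, whose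
vectors are the columns of U. -/
theorem Matrix.exists_singularValueDecomposition {N : ℕ} (M : Mat N) :
    ∃ (U W : Matrix.unitaryGroup (Fin N) ℂ) (σ : Fin N → ℝ), (∀ i, 0 ≤ σ i) ∧
      M = U.1 * Matrix.diagonal (fun i => (σ i : ℂ)) * star W.1 := by
  have hH : (Mᴴ * M).IsHermitian := Matrix.isHermitian_conjTranspose_mul_self M
  have hpos : (Mᴴ * M).PosSemidef := Matrix.posSemidef_conjTranspose_mul_self M
  let W := hH.eigenvectorUnitary
  let ev := hH.eigenvalues
  have hev : ∀ i, 0 ≤ ev i := hpos.eigenvalues_nonneg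
  let A : Mat N := M * W.1
  have hWW : W.1 * star W.1 = 1 := Unitary.mul_star_self_of_mem W.2
  have hWW' : star W.1 * W.1 = 1 := Unitary.star_mul_self_of_mem W.2
  have hA : Aᴴ * A = Matrix.diagonal fun i => (ev i : ℂ) := by
    have h : Mᴴ * M = W.1 * Matrix.diagonal (fun i => (ev i : ℂ)) * star W.1 := by
      have := hH.spectral_theorem
      rw [Unitary.conjStarAlgAut_apply] at this
      exact this
    have h2 : Aᴴ * A = star W.1 * (Mᴴ * M) * W.1 := by
      simp only [A, Matrix.conjTranspose_mul, Matrix.star_eq_conjTranspose, mul_assoc]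
    rw [h2, h]
    simp only [mul_assoc]
    rw [hWW', mul_one, ← mul_assoc, hWW', one_mul]
  let a : Fin N → EuclideanSpace ℂ (Fin N) := fun j => WithLp.toLp 2 fun i => A i j
  have ha : ∀ i j, inner ℂ (a i) (a j) = if i = j then (ev i : ℂ) else 0 := fun i j => by
    have := congrFun (congrFun hA i) j
    rw [Matrix.diagonal_apply, Matrix.mul_apply] at this
    rw [← this, PiLp.inner_apply]
    refine Finset.sum_congr rfl fun k _ => ?_
    rw [RCLike.inner_apply, mul_comm]
    rfl
  let u : Fin N → EuclideanSpace ℂ (Fin N) := fun j => ((√(ev j) : ℝ) : ℂ)⁻¹ • a j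
  have hu : Orthonormal ℂ (Set.domRestrict {j | ev j ≠ 0} u) := by
    rw [orthonormal_iff_ite]
    rintro ⟨i, hi⟩ ⟨j, hj⟩
    change inner ℂ (u i) (u j) = _
    have hi : ev i ≠ 0 := hi
    simp only [u, inner_smul_left, inner_smul_right, ha, Subtype.mk.injEq]
    split_ifs with hij
    · subst hij
      have h1 : ((√(ev i) : ℝ) : ℂ) * ((√(ev i) : ℝ) : ℂ) = (ev i : ℂ) := by
        rw [← Complex.ofReal_mul, Real.mul_self_sqrt (hev i)]
      have h2 : ((√(ev i) : ℝ) : ℂ) ≠ 0 := fun h => by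
        rw [h, zero_mul] at h1
        exact hi (Complex.ofReal_eq_zero.1 h1.symm)
      rw [map_inv₀, Complex.conj_ofReal, ← h1]
      field_simp
    · simp
  obtain ⟨b, hb⟩ := hu.exists_orthonormalBasis_extension_of_card_eq (by simp)
  have hab : ∀ i j, A i j = b j i * (√(ev j) : ℝ) := fun i j => by
    change a j i = _
    -- A column with eigenvalue 0 vanishes, so the basis vector chosen for it by the completion is
    -- irrelevant.
    by_cases hj : ev j = 0
    · have : a j = 0 := by
        rw [← inner_self_eq_zero (𝕜 := ℂ), ha, if_pos rfl, hj, Complex.ofReal_zero]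
      simp [this, hj]
    · rw [hb j hj]
      have h2 : ((√(ev j) : ℝ) : ℂ) ≠ 0 :=
        Complex.ofReal_ne_zero.2 (Real.sqrt_ne_zero'.2 ((hev j).lt_of_ne' hj))
      change _ = ((√(ev j) : ℝ) : ℂ)⁻¹ * a j i * _
      field_simp
  refine ⟨⟨(EuclideanSpace.basisFun (Fin N) ℂ).toBasis.toMatrix b,
    OrthonormalBasis.toMatrix_orthonormalBasis_mem_unitary _ _⟩, W, fun j => √(ev j),
    fun j => Real.sqrt_nonneg _, ?_⟩
  have hAU : A = (EuclideanSpace.basisFun (Fin N) ℂ).toBasis.toMatrix b *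
      Matrix.diagonal fun j => ((√(ev j) : ℝ) : ℂ) := by
    ext i j
    rw [Matrix.mul_diagonal, hab]
    simp [Module.Basis.toMatrix_apply]
  rw [← hAU]
  simp only [A]
  rw [mul_assoc, hWW, mul_one]

theorem localUnitary_schmidtVec_apply {N : ℕ} (U V : Matrix.unitaryGroup (Fin N) ℂ)
    (q : EuclideanSpace ℝ (Fin N)) (k l : Fin N) :
    localUnitary U V (schmidtVec q) (k, l) = ∑ j, U.1 k j * q j * V.1 l j := by
  change ∑ x : Fin N × Fin N, (U.1 k x.1 * V.1 l x.2) * (if x.1 = x.2 then (q x.1 : ℂ) else 0) = _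
  rw [Fintype.sum_prod_type]
  refine Finset.sum_congr rfl fun j _ => ?_
  rw [Finset.sum_eq_single j]
  · rw [if_pos rfl]
    ring
  · intro i _ hi
    rw [if_neg fun h => hi h.symm, mul_zero]
  · simp

theorem norm_localUnitary {N : ℕ} (U V : Matrix.unitaryGroup (Fin N) ℂ) (φ : BiVec N) :
    ‖localUnitary U V φ‖ = ‖φ‖ := by
  have hW : star (U.1 ⊗ₖ V.1) * (U.1 ⊗ₖ V.1) = 1 := by
    rw [Matrix.star_eq_conjTranspose, Matrix.conjTranspose_kronecker, ← Matrix.mul_kronecker_mul,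
      ← Matrix.star_eq_conjTranspose, ← Matrix.star_eq_conjTranspose,
      Unitary.star_mul_self_of_mem U.2, Unitary.star_mul_self_of_mem V.2, Matrix.one_kronecker_one]
  have h : inner ℂ (localUnitary U V φ) (localUnitary U V φ) = inner ℂ φ φ := by
    rw [EuclideanSpace.inner_eq_star_dotProduct, EuclideanSpace.inner_eq_star_dotProduct]
    change ((U.1 ⊗ₖ V.1).mulVec φ.ofLp) ⬝ᵥ star ((U.1 ⊗ₖ V.1).mulVec φ.ofLp) = _
    rw [dotProduct_comm, Matrix.star_mulVec, ← Matrix.dotProduct_mulVec, Matrix.mulVec_mulVec,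
      ← Matrix.star_eq_conjTranspose, hW, Matrix.one_mulVec, dotProduct_comm]
  rw [inner_self_eq_norm_sq_to_K, inner_self_eq_norm_sq_to_K] at h
  have h' : ‖localUnitary U V φ‖ ^ 2 = ‖φ‖ ^ 2 := by exact_mod_cast h
  exact (sq_eq_sq₀ (norm_nonneg _) (norm_nonneg _)).1 h'

theorem norm_schmidtVec_sq {N : ℕ} (q : EuclideanSpace ℝ (Fin N)) :
    ‖schmidtVec q‖ ^ 2 = ∑ i, q i ^ 2 := by
  rw [EuclideanSpace.norm_sq_eq, Fintype.sum_prod_type]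
  refine Finset.sum_congr rfl fun j _ => ?_
  rw [Finset.sum_eq_single j]
  · simp [schmidtVec]
  · intro i _ hi
    simp [schmidtVec, hi.symm]
  · simp

theorem norm_schmidtVec {n : ℕ+} {q : EuclideanSpace ℝ (Fin (2 ^ (n : ℕ)))}
    (hq : q ∈ schmidtSet n) : ‖schmidtVec q‖ = 1 := by
  have h := norm_schmidtVec_sq q
  rw [hq.2] at h
  exact (pow_eq_one_iff_of_nonneg (norm_nonneg _) two_ne_zero).1 h

theorem exists_schmidtDecomposition {N : ℕ} (φ : BiVec N) :
    ∃ (U V : Matrix.unitaryGroup (Fin N) ℂ) (q : EuclideanSpace ℝ (Fin N)), (∀ i, 0 ≤ q i) ∧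
      φ = localUnitary U V (schmidtVec q) := by
  obtain ⟨U, W, σ, hσ, hM⟩ := Matrix.exists_singularValueDecomposition
    (Matrix.of fun k l => φ (k, l))
  -- The coefficient matrix of (U ⊗ V)φ_q is U diag(q) Vᵀ; comparison with U diag(σ) W⋆ gives V =
  -- (W⋆)ᵀ.
  refine ⟨U, Matrix.UnitaryGroup.transpose (star W), WithLp.toLp 2 σ, hσ, ?_⟩
  ext ⟨k, l⟩
  rw [localUnitary_schmidtVec_apply]
  have := congrFun (congrFun hM k) l
  rw [Matrix.of_apply, Matrix.mul_apply] at this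
  rw [this]
  refine Finset.sum_congr rfl fun j _ => ?_
  rw [Matrix.mul_diagonal]
  rfl

theorem targets_subset_sphere (n : ℕ+) : targets n ⊆ Metric.sphere 0 1 := by
  rintro _ ⟨q, hq, U, V, rfl⟩
  rw [mem_sphere_zero_iff_norm, norm_localUnitary, norm_schmidtVec hq]

theorem continuous_localUnitary_schmidtVec {N : ℕ} (U V : Matrix.unitaryGroup (Fin N) ℂ) :
    Continuous fun q : EuclideanSpace ℝ (Fin N) => localUnitary U V (schmidtVec q) := by
  refine (PiLp.continuous_toLp 2 _).comp (continuous_pi fun x => ?_)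
  obtain ⟨k, l⟩ := x
  simp only [← show ∀ q : EuclideanSpace ℝ (Fin N), localUnitary U V (schmidtVec q) (k, l) =
    ((U.1 ⊗ₖ V.1).mulVec (schmidtVec q).ofLp) (k, l) from fun _ => rfl,
    localUnitary_schmidtVec_apply]
  fun_prop

/-- The unitaries of a Schmidt decomposition are kept fixed and only the Schmidt vector is
approximated. -/
theorem sphere_subset_closure_targets (n : ℕ+) : Metric.sphere 0 1 ⊆ closure (targets n) := by
  intro φ hφ
  obtain ⟨U, V, q, hq, rfl⟩ := exists_schmidtDecomposition φ
  have hsum : ∑ i, q i ^ 2 = 1 := by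
    rw [← norm_schmidtVec_sq, ← norm_localUnitary U V, mem_sphere_zero_iff_norm.1 hφ, one_pow]
  refine closure_mono ?_ (mem_closure_image (f := fun q => localUnitary U V (schmidtVec q))
    (continuous_localUnitary_schmidtVec U V).continuousAt
    (subset_closure_schmidtSet n ⟨hq, hsum⟩))
  rintro _ ⟨q', hq', rfl⟩
  exact ⟨q', hq', U, V, rfl⟩

/-! ### Embezzlement -/

theorem expect_conj {N : ℕ} (U V : Matrix.unitaryGroup (Fin N) ℂ) (φ : BiVec N) (m m' : Mat N) :
    expect φ (star U.1 * m * U.1) (star V.1 * m' * V.1) = expect (localUnitary U V φ) m m' := by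
  have h : (star U.1 * m * U.1) ⊗ₖ (star V.1 * m' * V.1) =
      star (U.1 ⊗ₖ V.1) * (m ⊗ₖ m') * (U.1 ⊗ₖ V.1) := by
    rw [Matrix.mul_kronecker_mul, Matrix.mul_kronecker_mul, Matrix.star_eq_conjTranspose (_ ⊗ₖ _),
      Matrix.conjTranspose_kronecker]
    rfl
  rw [expect, expect, EuclideanSpace.inner_eq_star_dotProduct,
    EuclideanSpace.inner_eq_star_dotProduct, h]
  change (_ *ᵥ φ.ofLp) ⬝ᵥ star φ.ofLp =
    ((m ⊗ₖ m') *ᵥ ((U.1 ⊗ₖ V.1) *ᵥ φ.ofLp)) ⬝ᵥ star ((U.1 ⊗ₖ V.1) *ᵥ φ.ofLp)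
  rw [dotProduct_comm, dotProduct_comm _ (star ((U.1 ⊗ₖ V.1) *ᵥ φ.ofLp)), Matrix.star_mulVec,
    ← Matrix.dotProduct_mulVec, Matrix.mulVec_mulVec, Matrix.mulVec_mulVec,
    Matrix.star_eq_conjTranspose, mul_assoc]

theorem rotate_tmul {A : Type*} [CStarAlgebra A] {N : ℕ} (U : Matrix.unitaryGroup (Fin N) ℂ)
    (a : A) (m : Mat N) : rotate U (.tmul a m) = .tmul a (star U.1 * m * U.1) := by
  rw [rotate, Unitary.conjStarAlgAut_symm_apply]
  change star (MaxTensor.inr U.1) * MaxTensor.tmul a m * MaxTensor.inr U.1 = _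
  rw [← map_star, MaxTensor.inr_apply, MaxTensor.inr_apply, MaxTensor.tmul_mul_tmul,
    MaxTensor.tmul_mul_tmul, one_mul, mul_one]

theorem IsTensorVectorState.comp_rotate {A B : Type*} [CStarAlgebra A] [CStarAlgebra B] {N : ℕ}
    {s : MaxTensor A B →ₗ[ℂ] ℂ} {φ : BiVec N}
    {σ : MaxTensor (MaxTensor A (Mat N)) (MaxTensor B (Mat N)) →ₗ[ℂ] ℂ}
    (hσ : IsTensorVectorState s φ σ) (U V : Matrix.unitaryGroup (Fin N) ℂ) :
    IsTensorVectorState s (localUnitary U V φ) (σ ∘ₗ (MaxTensor.map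
      (rotate (A := A) U : MaxTensor A (Mat N) →⋆ₐ[ℂ] MaxTensor A (Mat N))
      (rotate (A := B) V : MaxTensor B (Mat N) →⋆ₐ[ℂ] MaxTensor B (Mat N))).toAlgHom.toLinearMap) := by
  refine ⟨hσ.isState.comp _, fun a m b m' => ?_⟩
  change σ (MaxTensor.map (rotate (A := A) U : MaxTensor A (Mat N) →⋆ₐ[ℂ] MaxTensor A (Mat N))
      (rotate (A := B) V : MaxTensor B (Mat N) →⋆ₐ[ℂ] MaxTensor B (Mat N)) (.tmul _ _)) = _
  rw [MaxTensor.map_tmul]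
  change σ (.tmul (rotate U _) (rotate V _)) = _
  rw [rotate_tmul, rotate_tmul, hσ.apply_tmul, expect_conj]

/-- With no register there would be no sites at all; nonemptiness makes the set of sites infinite,
as the comparison with the CAR algebra requires. -/
instance : Nonempty Register := by
  have h : (schmidtSet 1).Nonempty := by
    -- The basis vector has a zero coordinate, so it is not in the set, but it is in its closure,
    -- which is enough.
    refine closure_nonempty_iff.1 ⟨EuclideanSpace.single 0 1, subset_closure_schmidtSet 1 ?_⟩
    refine ⟨fun i => ?_, ?_⟩
    · rw [PiLp.single_apply]
      split_ifs <;> norm_num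
    · rw [Finset.sum_eq_single 0]
      · rw [PiLp.single_apply, if_pos rfl, one_pow]
      · intro i _ hi
        rw [PiLp.single_apply, if_neg hi, zero_pow two_ne_zero]
      · exact fun h => (h (Finset.mem_univ 0)).elim
  exact ⟨⟨1, h.some, h.some_mem⟩⟩

instance : Countable Register := by
  have : ∀ n : ℕ+, Countable (schmidtSet n) := fun n => (countable_schmidtSet n).to_subtype
  infer_instance

theorem isCatalyst_iff {s : MaxTensor CatalystAlgebra CatalystAlgebra →ₗ[ℂ] ℂ} :
    IsCatalyst s ↔ InfTensor.IsProductState s fun x => expect (siteVec x.1 x.2) :=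
  ⟨fun h => ⟨h.isState, h.apply_prod⟩, fun h => ⟨h.isState, h.apply_prod⟩⟩

theorem norm_ket00 (N : ℕ) [NeZero N] : ‖ket00 N‖ = 1 := by
  simp [ket00]

theorem norm_siteVec (r : Register) (i : ℤ) : ‖siteVec r i‖ = 1 := by
  rw [siteVec]
  split_ifs
  · exact norm_schmidtVec r.2.2
  · exact norm_ket00 _

/-! ### The shift through the external system, and the embezzlement. -/

section ShiftSwap

open InfTensor

variable (r : Register)

/-- The local dimensions of the catalyst and of the external system. -/
abbrev extDim : Option (Register × ℤ) → ℕ := optionDim (fun x : Register × ℤ => x.1.dim) r.dim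

open scoped Classical in
/-- The permutation of the sites, and the external system, that shifts the chain of `r`. -/
def shiftPerm : Equiv.Perm (Option (Register × ℤ)) :=
  (Equiv.optionCongr (Equiv.prodShear (Equiv.refl Register) fun r' =>
    if r' = r then Equiv.addRight (1 : ℤ) else Equiv.refl ℤ)).trans
      -- The shift acts first: position 0 arrives at 1 and is then exchanged with the external site,
      -- which itself ends at 1.
      (Equiv.swap none (some (r, 1)))

theorem shiftPerm_none : shiftPerm r none = some (r, 1) := by
  simp [shiftPerm]

theorem shiftPerm_zero : shiftPerm r (some (r, 0)) = none := by
  simp [shiftPerm]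

theorem shiftPerm_self {i : ℤ} (hi : i ≠ 0) : shiftPerm r (some (r, i)) = some (r, i + 1) := by
  classical
  rw [shiftPerm]
  simp only [Equiv.trans_apply, Equiv.optionCongr_apply, Option.map_some, Equiv.prodShear_apply,
    Equiv.refl_apply, if_true, Equiv.coe_addRight]
  exact Equiv.swap_apply_of_ne_of_ne (by simp) (by simpa using hi)

theorem shiftPerm_other {r' : Register} (hr : r' ≠ r) (i : ℤ) :
    shiftPerm r (some (r', i)) = some (r', i) := by
  classical
  rw [shiftPerm]
  simp only [Equiv.trans_apply, Equiv.optionCongr_apply, Option.map_some, Equiv.prodShear_apply,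
    Equiv.refl_apply, if_neg hr]
  exact Equiv.swap_apply_of_ne_of_ne (by simp) (by simp [hr])

theorem extDim_shiftPerm (o : Option (Register × ℤ)) :
    extDim r o = extDim r (shiftPerm r o) := by
  rcases o with _ | ⟨r', i⟩
  · rw [shiftPerm_none]
    rfl
  · by_cases hr : r' = r
    · subst hr
      by_cases hi : i = 0
      · subst hi
        rw [shiftPerm_zero]
        rfl
      · rw [shiftPerm_self r' hi]
        rfl
    · rw [shiftPerm_other r hr]

theorem site_shiftPerm {o o' : Option (Register × ℤ)} (h : shiftPerm r o = o')
    (m : Mat (extDim r o)) :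
    congr (shiftPerm r) (extDim_shiftPerm r) (site (d := extDim r) o m) =
      site (d := extDim r) o' (castMat (h ▸ extDim_shiftPerm r o) m) := by
  subst h
  exact congr_site _ _ _ _

/-- The automorphism that shifts the chain of the register `r`, after the swap of the position `0`
with the external system. -/
def shiftSwap : MaxTensor CatalystAlgebra (Mat r.dim) ≃⋆ₐ[ℂ]
    MaxTensor CatalystAlgebra (Mat r.dim) :=
  ((optionEquiv (fun x : Register × ℤ => x.1.dim) r.dim).trans
    (congr (shiftPerm r) (extDim_shiftPerm r))).trans
      (optionEquiv (fun x : Register × ℤ => x.1.dim) r.dim).symm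

theorem optionEquiv_shiftSwap (x : MaxTensor CatalystAlgebra (Mat r.dim)) :
    optionEquiv (fun x : Register × ℤ => x.1.dim) r.dim (shiftSwap r x) =
      congr (shiftPerm r) (extDim_shiftPerm r)
        (optionEquiv (fun x : Register × ℤ => x.1.dim) r.dim x) :=
  StarAlgEquiv.apply_symm_apply _ _

theorem optionEquiv_tmul_siteAt (r' : Register) (i : ℤ) (m : Mat r'.dim) :
    optionEquiv (fun x : Register × ℤ => x.1.dim) r.dim (.tmul (siteAt r' i m) 1) =
      site (d := extDim r) (some (r', i)) m :=
  optionEquiv_inl_site _ _ _ _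

theorem optionEquiv_one_tmul (m : Mat r.dim) :
    optionEquiv (fun x : Register × ℤ => x.1.dim) r.dim (.tmul 1 m) =
      site (d := extDim r) none m :=
  optionEquiv_inr _ _ _

/-- The image site is a variable with an equation. For each of the four kinds of sites the two
dimensions agree definitionally, so the cast disappears and `hy` holds by the plain evaluation of
`optionEquiv`. -/
theorem shiftSwap_eq_of_site {o o' : Option (Register × ℤ)} (h : shiftPerm r o = o')
    {x y : MaxTensor CatalystAlgebra (Mat r.dim)} (m : Mat (extDim r o))
    (hx : optionEquiv (fun x : Register × ℤ => x.1.dim) r.dim x = site (d := extDim r) o m)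
    (hy : optionEquiv (fun x : Register × ℤ => x.1.dim) r.dim y =
      site (d := extDim r) o' (castMat (h ▸ extDim_shiftPerm r o) m)) :
    shiftSwap r x = y := by
  refine EquivLike.injective (optionEquiv (fun x : Register × ℤ => x.1.dim) r.dim) ?_
  rw [optionEquiv_shiftSwap, hx, hy, site_shiftPerm r h]

theorem isShiftSwap_shiftSwap : IsShiftSwap r (shiftSwap r) where
  other r' hr i m := shiftSwap_eq_of_site r (shiftPerm_other r hr i) m
    (optionEquiv_tmul_siteAt r r' i m) (optionEquiv_tmul_siteAt r r' i m)
  shift i hi m := shiftSwap_eq_of_site r (shiftPerm_self r hi) m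
    (optionEquiv_tmul_siteAt r r i m) (optionEquiv_tmul_siteAt r r (i + 1) m)
  swap_out m := shiftSwap_eq_of_site r (shiftPerm_zero r) m
    (optionEquiv_tmul_siteAt r r 0 m) (optionEquiv_one_tmul r m)
  swap_in m := shiftSwap_eq_of_site r (shiftPerm_none r) m
    (optionEquiv_one_tmul r m) (optionEquiv_tmul_siteAt r r 1 m)

/-- The vectors of the pairs of sites of the catalyst, and of an external pair in the vector
`φ`. -/
def extVec (φ : BiVec r.dim) : ∀ o, BiVec (extDim r o)
  | none => φ
  | some x => siteVec x.1 x.2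

theorem norm_extVec {φ : BiVec r.dim} (hφ : ‖φ‖ = 1) (o : Option (Register × ℤ)) :
    ‖extVec r φ o‖ = 1 := by
  rcases o with _ | x
  · exact hφ
  · exact norm_siteVec x.1 x.2

theorem expect_extVec_of_eq {φ : BiVec r.dim} {o o' : Option (Register × ℤ)}
    (h : shiftPerm r o = o') (m m' : Mat (extDim r o)) :
    expect (extVec r φ (shiftPerm r o)) (castMat (extDim_shiftPerm r o) m)
        (castMat (extDim_shiftPerm r o) m') =
      expect (extVec r φ o') (castMat (h ▸ extDim_shiftPerm r o) m)
        (castMat (h ▸ extDim_shiftPerm r o) m') := by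
  subst h
  rfl

theorem siteVec_of_pos {i : ℤ} (hi : 0 < i) : siteVec r i = schmidtVec r.2.1 := if_pos hi

theorem siteVec_of_nonpos {i : ℤ} (hi : i ≤ 0) : siteVec r i = ket00 r.dim := if_neg hi.not_gt

/-- The vector changes along the chain only between the positions 0 and 1. -/
theorem siteVec_add_one {i : ℤ} (hi : i ≠ 0) : siteVec r (i + 1) = siteVec r i := by
  rcases hi.lt_or_gt with h | h
  · rw [siteVec_of_nonpos r h.le, siteVec_of_nonpos r (by omega)]
  · rw [siteVec_of_pos r h, siteVec_of_pos r (by omega)]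

/-- The heart of the embezzlement, site by site: the external site takes the vector φ_q of position
1, position 0 takes the external |00⟩, and every other site keeps its vector. -/
theorem expect_extVec_shiftPerm (o : Option (Register × ℤ)) (m m' : Mat (extDim r o)) :
    expect (extVec r (ket00 r.dim) (shiftPerm r o)) (castMat (extDim_shiftPerm r o) m)
      (castMat (extDim_shiftPerm r o) m') = expect (extVec r (schmidtVec r.2.1) o) m m' := by
  rcases o with _ | ⟨r', i⟩
  · rw [expect_extVec_of_eq r (shiftPerm_none r)]
    rfl
  · by_cases hr : r' = r
    · subst hr
      by_cases hi : i = 0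
      · subst hi
        rw [expect_extVec_of_eq r' (shiftPerm_zero r')]
        rfl
      · rw [expect_extVec_of_eq r' (shiftPerm_self r' hi)]
        change expect (siteVec r' (i + 1)) m m' = expect (siteVec r' i) m m'
        rw [siteVec_add_one r' hi]
    · rw [expect_extVec_of_eq r (shiftPerm_other r hr i)]
      rfl

theorem embezzles_shiftSwap {s : MaxTensor CatalystAlgebra CatalystAlgebra →ₗ[ℂ] ℂ}
    (hs : IsCatalyst s) (U V : Matrix.unitaryGroup (Fin r.dim) ℂ) :
    Embezzles s ((rotate U).trans (shiftSwap r)) ((rotate V).trans (shiftSwap r))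
      (localUnitary U V (schmidtVec r.2.1)) := by
  have hs := isCatalyst_iff.1 hs
  -- The single product state `S`, with the external pair in |00⟩, yields both states of the
  -- definition: itself for s ⊗ s_00, and its pullback under the site permutation for s ⊗ s_{φ_q}.
  obtain ⟨S, hS⟩ := exists_isProductState (extVec r (ket00 r.dim))
    (norm_extVec r (norm_ket00 r.dim))
  have h0 := hs.isTensorVectorState (φ := ket00 r.dim) hS rfl fun _ => rfl
  have h1 := hs.isTensorVectorState (φ := schmidtVec r.2.1)
    (hS.comp_congr (shiftPerm r) (extDim_shiftPerm r))
    (funext fun m => funext fun m' => expect_extVec_shiftPerm r none m m')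
    (fun x => funext fun m => funext fun m' => expect_extVec_shiftPerm r (some x) m m')
  -- Both sides are `S` evaluated on the image of `X` under a *-homomorphism, so it remains to
  -- compare two homomorphisms, which is done on the two tensor factors.
  refine ⟨_, _, h0, h1.comp_rotate U V, fun X => congrArg S ?_⟩
  let Θ : MaxTensor CatalystAlgebra (Mat r.dim) →⋆ₐ[ℂ] InfTensor (extDim r) :=
    (optionEquiv (fun x : Register × ℤ => x.1.dim) r.dim : _ →⋆ₐ[ℂ] _)
  let K : InfTensor (extDim r) →⋆ₐ[ℂ] InfTensor (extDim r) :=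
    (congr (shiftPerm r) (extDim_shiftPerm r) : _ →⋆ₐ[ℂ] _)
  let R (U : Matrix.unitaryGroup (Fin r.dim) ℂ) : MaxTensor CatalystAlgebra (Mat r.dim) →⋆ₐ[ℂ]
    MaxTensor CatalystAlgebra (Mat r.dim) := (rotate (A := CatalystAlgebra) U : _ →⋆ₐ[ℂ] _)
  let Q (U : Matrix.unitaryGroup (Fin r.dim) ℂ) : MaxTensor CatalystAlgebra (Mat r.dim) →⋆ₐ[ℂ]
    MaxTensor CatalystAlgebra (Mat r.dim) := ((rotate U).trans (shiftSwap r) : _ →⋆ₐ[ℂ] _)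
  have hQ : ∀ U x, Θ (Q U x) = K (Θ (R U x)) := fun U x => optionEquiv_shiftSwap r (rotate U x)
  have key : (MaxTensor.map Θ Θ).comp (MaxTensor.map (Q U) (Q V)) =
      (MaxTensor.map K K).comp ((MaxTensor.map Θ Θ).comp (MaxTensor.map (R U) (R V))) := by
    refine MaxTensor.hom_ext (fun a => ?_) fun b => ?_
    · simp only [StarAlgHom.comp_apply, MaxTensor.inl_apply, MaxTensor.map_tmul, hQ, map_one]
    · simp only [StarAlgHom.comp_apply, MaxTensor.inr_apply, MaxTensor.map_tmul, hQ, map_one]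
  exact DFunLike.congr_fun key X

end ShiftSwap

/-! ### Identification with the CAR algebra, and the theorem. -/

theorem nonempty_catalystAlgebra_equiv : Nonempty (CatalystAlgebra ≃⋆ₐ[ℂ] CARAlgebra) :=
  InfTensor.nonempty_equiv_car (fun x : Register × ℤ => (x.1.1 : ℕ)) (fun x => x.1.1.pos)
    fun _ => rfl

theorem nonempty_maxTensor_equiv :
    Nonempty (MaxTensor CatalystAlgebra CatalystAlgebra ≃⋆ₐ[ℂ] CARAlgebra) := by
  obtain ⟨f⟩ := InfTensor.nonempty_equiv_car (d := Sum.elim (fun x : Register × ℤ => x.1.dim)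
    fun x : Register × ℤ => x.1.dim) (Sum.elim (fun x => (x.1.1 : ℕ)) fun x => (x.1.1 : ℕ))
    (by rintro (x | x) <;> exact x.1.1.pos) (by rintro (x | x) <;> rfl)
  exact ⟨InfTensor.sumEquiv.trans f⟩

end

theorem theorem3 :
    (∀ n, (schmidtSet n).Countable ∧
      {q | (∀ i, 0 ≤ q i) ∧ ∑ i, q i ^ 2 = 1} ⊆ closure (schmidtSet n)) ∧
    (∀ n, targets n ⊆ Metric.sphere 0 1 ∧ Metric.sphere 0 1 ⊆ closure (targets n)) ∧
    TopologicalSpace.SeparableSpace CatalystAlgebra ∧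
    Nonempty (CatalystAlgebra ≃⋆ₐ[ℂ] CARAlgebra) ∧
    Nonempty (MaxTensor CatalystAlgebra CatalystAlgebra ≃⋆ₐ[ℂ] CARAlgebra) ∧
    ∃ s : MaxTensor CatalystAlgebra CatalystAlgebra →ₗ[ℂ] ℂ,
      IsCatalyst s ∧ (∀ s', IsCatalyst s' → s' = s) ∧
      (∀ r : Register, ∃ α, IsShiftSwap r α ∧
        ∀ U V, Embezzles s ((rotate U).trans α) ((rotate V).trans α)
          (localUnitary U V (schmidtVec r.2.1))) ∧
      ∀ n, ∀ φ ∈ targets n, ∃ α β, Embezzles s α β φ := by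
  obtain ⟨s, hs⟩ := InfTensor.exists_isProductState
    (d := fun x : Register × ℤ => x.1.dim) (fun x => siteVec x.1 x.2)
    fun x => norm_siteVec x.1 x.2
  have hs' := isCatalyst_iff.2 hs
  refine ⟨fun n => ⟨countable_schmidtSet n, subset_closure_schmidtSet n⟩,
    fun n => ⟨targets_subset_sphere n, sphere_subset_closure_targets n⟩,
    InfTensor.separableSpace, nonempty_catalystAlgebra_equiv, nonempty_maxTensor_equiv,
    s, hs', fun s' h => (isCatalyst_iff.1 h).unique hs,
    fun r => ⟨shiftSwap r, isShiftSwap_shiftSwap r, embezzles_shiftSwap r hs'⟩, ?_⟩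
  rintro n _ ⟨q, hq, U, V, rfl⟩
  exact ⟨_, _, embezzles_shiftSwap ⟨n, q, hq⟩ hs' U V⟩
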